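/- **Certifiable lower bounds of non-Gaussian entanglement.** Let $m\ge 0$ and $N\ge 1$, and consider $M=2m$ bosonic modes, split into $m$ modes $A$ and $m$ modes $B$, with Hilbert space $\mathcal H=L^2(\mathbb R^m)\otimes L^2(\mathbb R^m)$. A state is a positive operator of unit trace on $\mathcal H$. For $\vec\xi\in\mathbb C^m$ let $D(\vec\xi)=\exp\big(\sum_k \xi_k a_k^\dagger-\xi_k^* a_k\big)$ be the displacement operator of $m$ modes, and put $D_A(\vec\xi)=D(\vec\xi)\otimes\mathbb 1$, $D_B(\vec\xi)=\mathbb 1\otimes D(\vec\xi)$. Let $T_B$ be the partial transposition on $B$ in the Fock (equivalently, position) basis and $\|T\|_1=\operatorname{tr}|T|\in[0,\infty]$ the trace norm. Let SEP be the set of separable states (trace-norm limits of finite convex combinations of product states $\rho_A\otimes\rho_B$) and PPT the set of states $\sigma$ with $\sigma^{T_B}\succeq 0$. Let $(\vec\xi_k^A,\vec\xi_k^B)\in\mathbb C^m\times\mathbb C^m$, $k=1,\dots,N$, and let $\Lambda\in\mathbb C^{2m\times 2m}$ satisfy $\Lambda^\dagger\begin{pmatrix}\mathbb 1&0\\0&-\mathbb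 1\end{pmatrix}\Lambda=\begin{pmatrix}\mathbb 1&0\\0&-\mathbb 1\end{pmatrix}$ and $$\begin{pmatrix}\vec\xi_k^A\\ \vec\xi_k^{A*}\end{pmatrix}=\Lambda\begin{pmatrix}\vec\xi_k^B\\ \vec\xi_k^{B*}\end{pmatrix}\qquad\text{for all }k .$$ For a state $\rho$ let $\mathbf C_2(\rho,\Xi)$ be the $N\times N$ matrix with entries $$[\mathbf C_2(\rho,\Xi)]_{j,k}=\frac1N\operatorname{tr}\big[\rho\, D_A(\vec\xi_j^A-\vec\xi_k^A)\,D_B(\vec\xi_j^B-\vec\xi_k^B)\big].$$ This matrix is Hermitian. Let $\lambda_-$ be its smallest eigenvalue and $\mathcal E_C(\rho,\Xi)=\max(0,-\lambda_-)$. Every state has a bounded partial transpose, and $$\mathcal E_C(\rho,\Xi)\le\inf_{\sigma\in\mathrm{SEP}}\|\sigma-\rho\|_1,\qquad \mathcal E_C(\rho,\Xi)\le\inf_{\sigma\in\mathrm{PPT}}\|\sigma^{T_B}-\rho^{T_B}\|_1 .$$ Moreover, with the Wigner function $W_\rho(\vec\alpha)=(2/\pi)^{2m}\operatorname{tr}[\rho\,\mathbf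 D(\vec\alpha)\,\Pi\,\mathbf D(\vec\alpha)^\dagger]$, where $\vec\alpha=(\vec\alpha_A,\vec\alpha_B)\in\mathbb C^{2m}$, $\mathbf D(\vec\alpha)=D_A(\vec\alpha_A)D_B(\vec\alpha_B)$ and $\Pi$ is the parity operator of all $2m$ modes, $\mathcal E_C$ bounds the Wigner negativity volume: $$\mathcal E_C(\rho,\Xi)\le\frac12\int_{\mathbb C^{2m}}\big(|W_\rho(\vec\alpha)|-W_\rho(\vec\alpha)\big)\,d\vec\alpha\in[0,\infty].$$ In particular, if $\mathcal E_C(\rho,\Xi)>0$, then $\rho$ is neither separable nor PPT, and $W_\rho$ takes a negative value. -/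

import Mathlib

open MeasureTheory
open scoped TensorProduct ENNReal Matrix

noncomputable section

namespace ECDWitness

/-! ### Trace, trace norm and states on a Hilbert space -/

section Trace

variable {H : Type*} [NormedAddCommGroup H] [InnerProductSpace ℂ H] [CompleteSpace H]

variable (H) in
/-- The index set of an orthonormal (Hilbert) basis of `H`. -/
def basisIndex : Set H := (exists_hilbertBasis ℂ H).choose

variable (H) in
/-- An orthonormal (Hilbert) basis of `H`; the traces below do not depend on this choice. -/
def basis : HilbertBasis (basisIndex H) ℂ H := (exists_hilbertBasis ℂ H).choose_spec.choose

/-- The trace `∑ᵢ ⟨eᵢ, T eᵢ⟩` of a trace class operator. -/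
def opTrace (T : H →L[ℂ] H) : ℂ := ∑' i, inner ℂ (basis H i) (T (basis H i))

/-- The trace, in `[0, ∞]`, of a positive operator. -/
def positiveTrace (T : H →L[ℂ] H) : ℝ≥0∞ :=
  ∑' i, ENNReal.ofReal (inner ℂ (basis H i) (T (basis H i))).re

/-- The trace norm `‖T‖₁ = tr |T|`, with `|T| = √(T† T)`; it is `∞` if `T` is not trace class. -/
def traceNorm (T : H →L[ℂ] H) : ℝ≥0∞ := positiveTrace (CFC.abs T)

/-- States (density operators): positive operators of unit trace. -/
def IsState (ρ : H →L[ℂ] H) : Prop := ρ.IsPositive ∧ positiveTrace ρ = 1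

end Trace

/-! ### Bosonic modes in the position representation -/

/-- The Hilbert space `L²(ℝᵐ)` of `m` modes. -/
abbrev ModeSpace (m : ℕ) : Type := Lp ℂ 2 (volume : Measure (Fin m → ℝ))

/-- The wave function of the displaced state,
`x ↦ exp(i ∑ₖ (√2 Im ξₖ xₖ - Re ξₖ Im ξₖ)) f(x - √2 Re ξ)`. -/
def displaceFun {m : ℕ} (ξ : Fin m → ℂ) (f : (Fin m → ℝ) → ℂ) (x : Fin m → ℝ) : ℂ :=
  Complex.exp (Complex.I *
      ((∑ k, (√2 * (ξ k).im * x k - (ξ k).re * (ξ k).im) : ℝ) : ℂ)) *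
    f (fun k => x k - √2 * (ξ k).re)

theorem measurePreserving_shift {m : ℕ} (ξ : Fin m → ℂ) :
    MeasurePreserving (fun (x : Fin m → ℝ) (k : Fin m) => x k - √2 * (ξ k).re) volume volume :=
  measurePreserving_sub_right volume (fun k => √2 * (ξ k).re)

theorem norm_displaceFun {m : ℕ} (ξ : Fin m → ℂ) (f : (Fin m → ℝ) → ℂ) (x : Fin m → ℝ) :
    ‖displaceFun ξ f x‖ = ‖f (fun k => x k - √2 * (ξ k).re)‖ := by
  rw [displaceFun, norm_mul, mul_comm Complex.I, Complex.norm_exp_ofReal_mul_I, one_mul]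

theorem aestronglyMeasurable_displaceFun {m : ℕ} (ξ : Fin m → ℂ) (f : ModeSpace m) :
    AEStronglyMeasurable (displaceFun ξ f) volume := by
  refine AEStronglyMeasurable.mul (Continuous.aestronglyMeasurable (by fun_prop)) ?_
  exact (Lp.aestronglyMeasurable f).comp_measurePreserving (measurePreserving_shift ξ)

theorem eLpNorm_displaceFun {m : ℕ} (ξ : Fin m → ℂ) (f : ModeSpace m) :
    eLpNorm (displaceFun ξ f) 2 volume = eLpNorm f 2 volume := by
  rw [← eLpNorm_comp_measurePreserving (Lp.aestronglyMeasurable f) (measurePreserving_shift ξ)]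
  exact eLpNorm_congr_norm_ae (Filter.Eventually.of_forall fun x => norm_displaceFun ξ f x)

theorem memLp_displaceFun {m : ℕ} (ξ : Fin m → ℂ) (f : ModeSpace m) :
    MemLp (displaceFun ξ f) 2 volume :=
  ⟨aestronglyMeasurable_displaceFun ξ f, by
    rw [eLpNorm_displaceFun]; exact Lp.eLpNorm_lt_top f⟩

/-- The displacement operator `D(ξ) = exp(∑ₖ ξₖ aₖ† - ξₖ* aₖ)`, where `aₖ = (xₖ + ∂ₖ)/√2`: since
`∑ₖ ξₖ aₖ† - ξₖ* aₖ = √2 ∑ₖ (i Im ξₖ xₖ - Re ξₖ ∂ₖ)`, the unitary group `t ↦ D(tξ)` that it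
generates acts on wave functions as `displaceFun (tξ)`. -/
def displacement {m : ℕ} (ξ : Fin m → ℂ) : ModeSpace m →L[ℂ] ModeSpace m :=
  LinearIsometry.toContinuousLinearMap
    { toFun := fun f => (memLp_displaceFun ξ f).toLp (displaceFun ξ f)
      map_add' := fun f g => by
        rw [← MemLp.toLp_add, MemLp.toLp_eq_toLp_iff]
        have h := (measurePreserving_shift ξ).quasiMeasurePreserving.ae (Lp.coeFn_add f g)
        filter_upwards [h] with x hx
        simp only [displaceFun, Pi.add_apply] at hx ⊢
        rw [hx, mul_add]
      map_smul' := fun c f => by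
        rw [RingHom.id_apply, ← MemLp.toLp_const_smul, MemLp.toLp_eq_toLp_iff]
        have h := (measurePreserving_shift ξ).quasiMeasurePreserving.ae (Lp.coeFn_smul c f)
        filter_upwards [h] with x hx
        simp only [displaceFun, Pi.smul_apply, smul_eq_mul] at hx ⊢
        rw [hx, mul_left_comm]
      norm_map' := fun f => by
        change ‖(memLp_displaceFun ξ f).toLp (displaceFun ξ f)‖ = ‖f‖
        rw [Lp.norm_toLp, eLpNorm_displaceFun, Lp.norm_def] }

/-- The parity operator `(Π f)(x) = f(-x)`. -/
def parity (m : ℕ) : ModeSpace m →L[ℂ] ModeSpace m :=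
  (Lp.compMeasurePreservingₗᵢ ℂ (fun x : Fin m → ℝ => -x)
    (Measure.measurePreserving_neg volume)).toContinuousLinearMap

/-- The displaced parity operator `D(α) Π D(α)†`. -/
def displacedParity {m : ℕ} (α : Fin m → ℂ) : ModeSpace m →L[ℂ] ModeSpace m :=
  displacement α * parity m * (displacement α).adjoint

/-! ### Two parties `A` and `B` with `m` modes each -/

/-- The Hilbert space tensor product of the mode spaces of `A` and `B`. -/
abbrev Bipartite (m : ℕ) : Type :=
  UniformSpace.Completion (ModeSpace m ⊗[ℂ] ModeSpace m)

/-- The product vector `f ⊗ g`. -/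
def productVector {m : ℕ} (f g : ModeSpace m) : Bipartite m := ((f ⊗ₜ[ℂ] g : _ ⊗[ℂ] _) :)

/-- The operator `S ⊗ T`. -/
def tensorOp {m : ℕ} (S T : ModeSpace m →L[ℂ] ModeSpace m) : Bipartite m →L[ℂ] Bipartite m :=
  (TensorProduct.mapL S T).completion

/-- The displacement operator of the modes of `A`. -/
def displacementA {m : ℕ} (ξ : Fin m → ℂ) : Bipartite m →L[ℂ] Bipartite m :=
  tensorOp (displacement ξ) 1

/-- The displacement operator of the modes of `B`. -/
def displacementB {m : ℕ} (ξ : Fin m → ℂ) : Bipartite m →L[ℂ] Bipartite m :=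
  tensorOp 1 (displacement ξ)

/-- `S = T^{T_B}`: for real wave functions `g`, `g'` this reads
`⟨f ⊗ g, S (f' ⊗ g')⟩ = ⟨f ⊗ g', T (f' ⊗ g)⟩`. Here `star g` is the complex conjugate of the wave
function `g`, so that the transposition is the one of the position basis, which is also the one of
the Fock basis since the Fock states have real wave functions. -/
def IsPartialTranspose {m : ℕ} (T S : Bipartite m →L[ℂ] Bipartite m) : Prop :=
  ∀ f f' g g' : ModeSpace m,
    inner ℂ (productVector f g) (S (productVector f' g')) =
      inner ℂ (productVector f (star g')) (T (productVector f' (star g)))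

open Classical in
/-- The partial transpose `T^{T_B}` (the default `0` is for bounded operators `T` that have no
bounded partial transpose; trace class operators have one). -/
def partialTranspose {m : ℕ} (T : Bipartite m →L[ℂ] Bipartite m) :
    Bipartite m →L[ℂ] Bipartite m :=
  if h : ∃ S, IsPartialTranspose T S then h.choose else 0

/-- The states `ρ_A ⊗ ρ_B`. -/
def productStates (m : ℕ) : Set (Bipartite m →L[ℂ] Bipartite m) :=
  {τ | ∃ ρA ρB : ModeSpace m →L[ℂ] ModeSpace m, IsState ρA ∧ IsState ρB ∧ τ = tensorOp ρA ρB}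

/-- The set SEP of separable states: limits in trace norm of finite mixtures of product states. -/
def SEP (m : ℕ) : Set (Bipartite m →L[ℂ] Bipartite m) :=
  {σ | IsState σ ∧ ∀ ε : ℝ≥0∞, 0 < ε →
    ∃ τ ∈ convexHull ℝ (productStates m), traceNorm (σ - τ) < ε}

/-- The set PPT of states with positive partial transpose. -/
def PPT (m : ℕ) : Set (Bipartite m →L[ℂ] Bipartite m) :=
  {σ | IsState σ ∧ (partialTranspose σ).IsPositive}

/-- The trace distance to the separable states. -/
def entanglementSEP {m : ℕ} (ρ : Bipartite m →L[ℂ] Bipartite m) : ℝ≥0∞ :=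
  ⨅ σ ∈ SEP m, traceNorm (σ - ρ)

/-- The trace distance between the partial transposes of `ρ` and of the PPT states. -/
def entanglementPPT {m : ℕ} (ρ : Bipartite m →L[ℂ] Bipartite m) : ℝ≥0∞ :=
  ⨅ σ ∈ PPT m, traceNorm (partialTranspose σ - partialTranspose ρ)

/-- The Wigner function `W_ρ(α) = (2/π)^{2m} tr[ρ D(α) Π D(α)†]` of the `2m` modes, where
`α = (α_A, α_B)` and `D(α)`, `Π` are the displacement and the parity of all modes; the trace is
real. -/
def wigner {m : ℕ} (ρ : Bipartite m →L[ℂ] Bipartite m) (α : (Fin m → ℂ) × (Fin m → ℂ)) : ℝ :=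
  (2 / Real.pi) ^ (2 * m) *
    (opTrace (ρ * tensorOp (displacedParity α.1) (displacedParity α.2))).re

/-- The Wigner negativity volume `½ ∫ (|W_ρ| - W_ρ)`, in `[0, ∞]`. -/
def negativityVolume {m : ℕ} (ρ : Bipartite m →L[ℂ] Bipartite m) : ℝ≥0∞ :=
  ∫⁻ α, ENNReal.ofReal ((|wigner ρ α| - wigner ρ α) / 2)

/-! ### The witness -/

/-- The matrix `diag(1, -1)`. -/
def signMatrix (m : ℕ) : Matrix (Fin m ⊕ Fin m) (Fin m ⊕ Fin m) ℂ :=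
  Matrix.fromBlocks 1 0 0 (-1)

/-- The column `(ξ, ξ*)`. -/
def doubled {m : ℕ} (ξ : Fin m → ℂ) : Fin m ⊕ Fin m → ℂ := Sum.elim ξ (star ξ)

/-- The matrix `C₂(ρ, Ξ)`. -/
def C₂ {m N : ℕ} (ρ : Bipartite m →L[ℂ] Bipartite m) (ξA ξB : Fin N → Fin m → ℂ) :
    Matrix (Fin N) (Fin N) ℂ :=
  Matrix.of fun j k => (1 / (N : ℂ)) *
    opTrace (ρ * displacementA (ξA j - ξA k) * displacementB (ξB j - ξB k))

/-- The real eigenvalues of a complex square matrix. -/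
def realEigenvalues {N : ℕ} (C : Matrix (Fin N) (Fin N) ℂ) : Set ℝ :=
  {μ | Module.End.HasEigenvalue (Matrix.toLin' C) (μ : ℂ)}

/-- The smallest eigenvalue of a Hermitian matrix. -/
def minEigenvalue {N : ℕ} (C : Matrix (Fin N) (Fin N) ℂ) : ℝ := sInf (realEigenvalues C)

/-- The quantity `max(0, -λ₋)`. -/
def witness {m N : ℕ} (ρ : Bipartite m →L[ℂ] Bipartite m) (ξA ξB : Fin N → Fin m → ℂ) : ℝ :=
  max 0 (-minEigenvalue (C₂ ρ ξA ξB))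

end ECDWitness

end

/-! Every bound is proved for the quadratic form v†C₂v at unit vectors v; a normalised eigenvector
of λ₋ then gives the bound for the witness (`ofReal_witness_le`).

Entanglement. Put θ = Im ∑ ξₖηₖ*. Then D(ξ)D(η)† and D(η)†D(ξ) are both D(ξ - η), up to the opposite
phases e^{-iθ} and e^{iθ}. Since Λ preserves diag(1,-1), θ is the same for corresponding pairs of A
and of B (`sum_im_eq_of_symplectic`). So D_A(ξⱼᴬ - ξₖᴬ) D_B(ξⱼᴮ - ξₖᴮ) factors without a phase if
the adjoint stands on the right for A and on the left for B (`tensorOp_displacement_sub`).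
Transposing B reverses the order there, and v†C₂v becomes (1/N) ∑ₚ ⟨F uₚ, ρ^{T_B} F uₚ⟩ with uₚ
orthonormal and F = ∑ⱼ vⱼ* D(ξⱼᴬ) ⊗ D(-(ξⱼᴮ)*) (`hasSum_quadForm`). This is nonnegative if ρ^{T_B}
is. For PPT σ one has -ρ^{T_B} ≤ σ^{T_B} - ρ^{T_B} ≤ |σ^{T_B} - ρ^{T_B}| as quadratic forms, and
‖F‖² ≤ (∑|vⱼ|)² ≤ N cancels the factor 1/N. For separable σ the form is nonnegative by approximation
with mixtures of product states. It is the expectation of an operator of norm at most 1, so Hölder's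
inequality bounds its change from σ to ρ by ‖σ - ρ‖₁.

Wigner negativity. Formally C₂ collects values of the Fourier transform of W, so v†C₂v = ∫ W |∑ⱼ vⱼ*
e^{ξⱼα* - ξⱼ*α}|²/N, where W is multiplied by a function with values in [0, 1]; hence v†C₂v is at
least minus the negativity volume. As W need not be integrable, a damping e^{-t²|α|²} is inserted.
It turns each D(ξ) into the Gaussian average of D(ξ + tz) (`integral_displacedParity_eq`), which
tends to D(ξ) strongly as t → 0.

All traces are reduced to Hilbert–Schmidt sums of the vectors √P eᵢ (`hasSum_inner_conj`), which
also give absolute convergence and independence of the basis. -/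

noncomputable section

namespace ECDWitness

set_option linter.unusedSectionVars false

/-! ### Hilbert–Schmidt sums and traces of positive operators -/

section Trace

variable {H : Type*} [NormedAddCommGroup H] [InnerProductSpace ℂ H] [CompleteSpace H]
variable {K : Type*} [NormedAddCommGroup K] [InnerProductSpace ℂ K] [CompleteSpace K]
variable {ι κ : Type*}

theorem hasSum_sq_norm_inner (b : HilbertBasis ι ℂ H) (x : H) :
    HasSum (fun i => ‖inner ℂ (b i) x‖ ^ 2) (‖x‖ ^ 2) := by
  have h := (b.hasSum_inner_mul_inner x x).mapL Complex.reCLM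
  rw [inner_self_eq_norm_sq_to_K] at h
  convert h using 1
  · ext i
    rw [← inner_conj_symm x (b i)]
    change _ = (starRingEnd ℂ (inner ℂ (b i) x) * inner ℂ (b i) x).re
    rw [mul_comm, Complex.mul_conj, Complex.ofReal_re, Complex.normSq_eq_norm_sq]
  · change _ = (((‖x‖ : ℝ) : ℂ) ^ 2).re
    rw [← Complex.ofReal_pow, Complex.ofReal_re]

theorem tsum_sq_enorm_inner (b : HilbertBasis ι ℂ H) (x : H) :
    ∑' i, ‖inner ℂ (b i) x‖ₑ ^ 2 = ‖x‖ₑ ^ 2 := by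
  have h := hasSum_sq_norm_inner b x
  have h2 := ENNReal.ofReal_tsum_of_nonneg (fun i => sq_nonneg ‖inner ℂ (b i) x‖) h.summable
  rw [h.tsum_eq] at h2
  simpa [ENNReal.ofReal_pow, ofReal_norm] using h2.symm

theorem tsum_sq_enorm_inner_le {u : ι → H} (hu : Orthonormal ℂ u) (x : H) :
    ∑' i, ‖inner ℂ (u i) x‖ₑ ^ 2 ≤ ‖x‖ₑ ^ 2 := by
  have h2 := ENNReal.ofReal_tsum_of_nonneg (fun i => sq_nonneg ‖inner ℂ (u i) x‖)
    (hu.inner_products_summable x)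
  have h3 := ENNReal.ofReal_le_ofReal (hu.tsum_inner_products_le x)
  rw [h2] at h3
  simpa [ENNReal.ofReal_pow, ofReal_norm] using h3

theorem enorm_inner_symm (x y : H) : ‖inner ℂ x y‖ₑ = ‖inner ℂ y x‖ₑ := by
  rw [← ofReal_norm, ← ofReal_norm, norm_inner_symm]

/-- Parseval in `c`, exchange of nonnegative sums, Bessel in `u`. Only orthonormality of `u` is
needed, so families such as eₐ ⊗ e_b* can be used without proving completeness. -/
theorem tsum_sq_enorm_adjoint_le {u : ι → K} (hu : Orthonormal ℂ u) (c : HilbertBasis κ ℂ H)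
    (A : K →L[ℂ] H) : ∑' i, ‖A (u i)‖ₑ ^ 2 ≤ ∑' j, ‖A.adjoint (c j)‖ₑ ^ 2 := by
  simp_rw [← tsum_sq_enorm_inner c]
  rw [ENNReal.tsum_comm]
  refine ENNReal.tsum_le_tsum fun j => ?_
  refine le_trans (le_of_eq ?_) (tsum_sq_enorm_inner_le hu (A.adjoint (c j)))
  congr 1
  ext i
  rw [ContinuousLinearMap.adjoint_inner_right, enorm_inner_symm]

theorem tsum_sq_enorm_adjoint (b : HilbertBasis ι ℂ K) (c : HilbertBasis κ ℂ H)
    (A : K →L[ℂ] H) : ∑' i, ‖A (b i)‖ₑ ^ 2 = ∑' j, ‖A.adjoint (c j)‖ₑ ^ 2 := by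
  refine le_antisymm (tsum_sq_enorm_adjoint_le b.orthonormal c A) ?_
  simpa using tsum_sq_enorm_adjoint_le c.orthonormal b A.adjoint

/-- The vectors `√P eᵢ`, for which `P = ∑ᵢ |√P eᵢ⟩⟨√P eᵢ|`. -/
def sqrtVec (P : H →L[ℂ] H) (i : basisIndex H) : H := CFC.sqrt P (basis H i)

theorem isSelfAdjoint_sqrt (P : H →L[ℂ] H) : (CFC.sqrt P).adjoint = CFC.sqrt P :=
  (IsSelfAdjoint.of_nonneg (CFC.sqrt_nonneg P)).adjoint_eq

theorem inner_sqrt_sqrt {P : H →L[ℂ] H} (hP : P.IsPositive) (x y : H) :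
    inner ℂ (CFC.sqrt P x) (CFC.sqrt P y) = inner ℂ x (P y) := by
  rw [← ContinuousLinearMap.adjoint_inner_right, isSelfAdjoint_sqrt, ← mul_apply_eq_comp,
    CFC.sqrt_mul_sqrt_self P (P.nonneg_iff_isPositive.2 hP)]

theorem ofReal_re_inner_eq {P : H →L[ℂ] H} (hP : P.IsPositive) (x : H) :
    ENNReal.ofReal (inner ℂ x (P x)).re = ‖CFC.sqrt P x‖ₑ ^ 2 := by
  rw [← inner_sqrt_sqrt hP, inner_self_eq_norm_sq_to_K]
  change ENNReal.ofReal (((‖CFC.sqrt P x‖ : ℝ) : ℂ) ^ 2).re = _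
  rw [← Complex.ofReal_pow, Complex.ofReal_re, ENNReal.ofReal_pow (norm_nonneg _), ofReal_norm]

theorem positiveTrace_eq {P : H →L[ℂ] H} (hP : P.IsPositive) :
    positiveTrace P = ∑' i, ‖sqrtVec P i‖ₑ ^ 2 := by
  simp only [positiveTrace, sqrtVec, ofReal_re_inner_eq hP]

theorem exists_selfAdjoint_mul_self {P : H →L[ℂ] H} (hP : P.IsPositive) :
    ∃ A : H →L[ℂ] H, A.adjoint = A ∧ A * A = P :=
  ⟨CFC.sqrt P, isSelfAdjoint_sqrt P,
    CFC.sqrt_mul_sqrt_self P (P.nonneg_iff_isPositive.2 hP)⟩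

theorem positiveTrace_adjoint_mul_self (A : H →L[ℂ] H) :
    positiveTrace (A.adjoint * A) = ∑' i, ‖A (basis H i)‖ₑ ^ 2 := by
  rw [positiveTrace]
  congr 1
  ext i
  rw [mul_apply_eq_comp, ContinuousLinearMap.adjoint_inner_right, inner_self_eq_norm_sq_to_K]
  change ENNReal.ofReal (((‖A (basis H i)‖ : ℝ) : ℂ) ^ 2).re = _
  rw [← Complex.ofReal_pow, Complex.ofReal_re, ENNReal.ofReal_pow (norm_nonneg _), ofReal_norm]

/-- The terms are ‖√P X uᵢ‖²; passing to the adjoint X†√P leaves ‖X‖² times the Hilbert–Schmidt sum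
of √P. This is tr(X†PX) ≤ ‖X‖² tr P, valid also when tr P = ∞. -/
theorem tsum_ofReal_re_inner_le {P : H →L[ℂ] H} (hP : P.IsPositive) (X : K →L[ℂ] H) {u : ι → K}
    (hu : Orthonormal ℂ u) :
    ∑' i, ENNReal.ofReal (inner ℂ (X (u i)) (P (X (u i)))).re ≤ ‖X‖ₑ ^ 2 * positiveTrace P := by
  simp_rw [ofReal_re_inner_eq hP]
  refine (tsum_sq_enorm_adjoint_le hu (basis H) (CFC.sqrt P ∘L X)).trans ?_
  rw [positiveTrace_eq hP, ← ENNReal.tsum_mul_left]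
  refine ENNReal.tsum_le_tsum fun i => ?_
  rw [ContinuousLinearMap.adjoint_comp, isSelfAdjoint_sqrt, ← mul_pow]
  gcongr
  have := (X.adjoint).le_opENorm (sqrtVec P i)
  have hX : ‖X.adjoint‖ₑ = ‖X‖ₑ := by
    rw [← ofReal_norm, ← ofReal_norm, LinearIsometryEquiv.norm_map]
  rwa [hX] at this

theorem summable_sq_norm_sqrtVec {P : H →L[ℂ] H} (hP : P.IsPositive) (hT : positiveTrace P ≠ ⊤) :
    Summable fun i => ‖sqrtVec P i‖ ^ 2 := by
  rw [positiveTrace_eq hP] at hT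
  have h := ENNReal.summable_toReal hT
  simpa using h

theorem tsum_sq_norm_sqrtVec {P : H →L[ℂ] H} (hP : P.IsPositive) :
    ∑' i, ‖sqrtVec P i‖ ^ 2 = (positiveTrace P).toReal := by
  rw [positiveTrace_eq hP, ENNReal.tsum_toReal_eq (fun i => by simp)]
  simp

theorem hasSum_inner_sqrtVec {P : H →L[ℂ] H} (hP : P.IsPositive) (x y : H) :
    HasSum (fun i => inner ℂ x (sqrtVec P i) * inner ℂ (sqrtVec P i) y) (inner ℂ x (P y)) := by
  have h := (basis H).hasSum_inner_mul_inner (CFC.sqrt P x) (CFC.sqrt P y)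
  rw [inner_sqrt_sqrt hP] at h
  have e : (fun i => inner ℂ x (sqrtVec P i) * inner ℂ (sqrtVec P i) y) = fun i =>
      inner ℂ (CFC.sqrt P x) (basis H i) * inner ℂ (basis H i) (CFC.sqrt P y) := by
    funext i
    simp only [sqrtVec]
    rw [← ContinuousLinearMap.adjoint_inner_left, isSelfAdjoint_sqrt,
      ← ContinuousLinearMap.adjoint_inner_left (CFC.sqrt P) y, isSelfAdjoint_sqrt]
  rw [e]
  exact h

/-- Each product is bounded by the sum of two squares, and the squares sum to ∑ₙ ‖W†√P eₙ‖² ≤ ‖W†‖²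
tr P. This absolute convergence justifies exchanging the sums in `hasSum_inner_conj`. -/
theorem summable_inner_inner {P : H →L[ℂ] H} (hP : P.IsPositive) (hT : positiveTrace P ≠ ⊤)
    (W₁ W₂ : K →L[ℂ] H) (c : HilbertBasis κ ℂ K) :
    Summable fun p : basisIndex H × κ =>
      inner ℂ (sqrtVec P p.1) (W₁ (c p.2)) * inner ℂ (W₂ (c p.2)) (sqrtVec P p.1) := by
  have key : ∀ W : K →L[ℂ] H, Summable fun p : basisIndex H × κ =>
      ‖inner ℂ (W (c p.2)) (sqrtVec P p.1)‖ ^ 2 := by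
    intro W
    rw [summable_prod_of_nonneg (fun _ => sq_nonneg _)]
    have h1 : ∀ n, HasSum (fun j => ‖inner ℂ (W (c j)) (sqrtVec P n)‖ ^ 2)
        (‖W.adjoint (sqrtVec P n)‖ ^ 2) := fun n => by
      simpa [ContinuousLinearMap.adjoint_inner_right] using
        hasSum_sq_norm_inner c (W.adjoint (sqrtVec P n))
    refine ⟨fun n => (h1 n).summable, ?_⟩
    simp_rw [fun n => (h1 n).tsum_eq]
    refine Summable.of_nonneg_of_le (fun _ => sq_nonneg _) (fun n => ?_)
      ((summable_sq_norm_sqrtVec hP hT).mul_left (‖W.adjoint‖ ^ 2))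
    rw [← mul_pow]
    gcongr
    exact W.adjoint.le_opNorm _
  refine Summable.of_norm_bounded ((key W₁).add (key W₂)) fun p => ?_
  rw [norm_mul, norm_inner_symm]
  nlinarith [sq_nonneg (‖inner ℂ (W₁ (c p.2)) (sqrtVec P p.1)‖ -
    ‖inner ℂ (W₂ (c p.2)) (sqrtVec P p.1)‖), sq_nonneg ‖inner ℂ (W₁ (c p.2)) (sqrtVec P p.1)‖,
    sq_nonneg ‖inner ℂ (W₂ (c p.2)) (sqrtVec P p.1)‖]

/-- The trace of `W₂† P W₁`, computed in an arbitrary basis. -/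
theorem hasSum_inner_conj {P : H →L[ℂ] H} (hP : P.IsPositive) (hT : positiveTrace P ≠ ⊤)
    (W₁ W₂ : K →L[ℂ] H) (c : HilbertBasis κ ℂ K) :
    HasSum (fun j => inner ℂ (W₂ (c j)) (P (W₁ (c j))))
      (∑' n, inner ℂ (W₁.adjoint (sqrtVec P n)) (W₂.adjoint (sqrtVec P n))) := by
  have hs := summable_inner_inner hP hT W₁ W₂ c
  have h1 : ∀ n, HasSum (fun j => inner ℂ (sqrtVec P n) (W₁ (c j)) *
      inner ℂ (W₂ (c j)) (sqrtVec P n))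
      (inner ℂ (W₁.adjoint (sqrtVec P n)) (W₂.adjoint (sqrtVec P n))) := fun n => by
    simpa [ContinuousLinearMap.adjoint_inner_right, ContinuousLinearMap.adjoint_inner_left] using
      c.hasSum_inner_mul_inner (W₁.adjoint (sqrtVec P n)) (W₂.adjoint (sqrtVec P n))
  have h2 : ∀ j, HasSum (fun n => inner ℂ (sqrtVec P n) (W₁ (c j)) *
      inner ℂ (W₂ (c j)) (sqrtVec P n)) (inner ℂ (W₂ (c j)) (P (W₁ (c j)))) := fun j => by
    simpa [mul_comm] using hasSum_inner_sqrtVec hP (W₂ (c j)) (W₁ (c j))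
  -- The same double sum is evaluated in both orders: over j first by Parseval in `c`, over n first
  -- by the expansion of P.
  have h3 := hs.hasSum.prod_fiberwise h1
  rw [h3.tsum_eq]
  exact ((Equiv.prodComm _ _).hasSum_iff.2 hs.hasSum).prod_fiberwise h2

theorem hasSum_opTrace_mul {P : H →L[ℂ] H} (hP : P.IsPositive) (hT : positiveTrace P ≠ ⊤)
    (O : H →L[ℂ] H) :
    HasSum (fun i => inner ℂ (basis H i) ((P * O) (basis H i))) (opTrace (P * O)) := by
  have h := hasSum_inner_conj hP hT O 1 (basis H)
  exact h.summable.hasSum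

/-- In this form the trace is dominated by ‖O‖ ∑ₙ ‖√P eₙ‖² = ‖O‖ tr P, which later gives Hölder's
inequality, continuity and exchange with integrals. -/
theorem opTrace_mul_eq {P : H →L[ℂ] H} (hP : P.IsPositive) (hT : positiveTrace P ≠ ⊤)
    (O : H →L[ℂ] H) :
    opTrace (P * O) = ∑' n, inner ℂ (sqrtVec P n) (O (sqrtVec P n)) := by
  have h := hasSum_inner_conj hP hT O 1 (basis H)
  have h' := h.tsum_eq
  simp_rw [ContinuousLinearMap.adjoint_inner_right, one_apply_eq_self,
    ContinuousLinearMap.adjoint_inner_left] at h'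
  exact h'

/-- Cyclicity of the trace, used to distribute a factored observable over the two sides of P. -/
theorem hasSum_opTrace_conj {P : H →L[ℂ] H} (hP : P.IsPositive) (hT : positiveTrace P ≠ ⊤)
    (W₁ W₂ : K →L[ℂ] H) (c : HilbertBasis κ ℂ K) :
    HasSum (fun j => inner ℂ (W₂ (c j)) (P (W₁ (c j)))) (opTrace (P * (W₁ ∘L W₂.adjoint))) := by
  rw [opTrace_mul_eq hP hT]
  simpa [ContinuousLinearMap.adjoint_inner_left] using hasSum_inner_conj hP hT W₁ W₂ c

theorem norm_opTrace_mul_le {P : H →L[ℂ] H} (hP : P.IsPositive) (hT : positiveTrace P ≠ ⊤)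
    (O : H →L[ℂ] H) : ‖opTrace (P * O)‖ ≤ (positiveTrace P).toReal * ‖O‖ := by
  rw [opTrace_mul_eq hP hT, ← tsum_sq_norm_sqrtVec hP]
  refine tsum_of_norm_bounded ((summable_sq_norm_sqrtVec hP hT).hasSum.mul_right ‖O‖) fun n => ?_
  calc _ ≤ ‖sqrtVec P n‖ * ‖O (sqrtVec P n)‖ := norm_inner_le_norm _ _
    _ ≤ ‖sqrtVec P n‖ * (‖O‖ * ‖sqrtVec P n‖) := by gcongr; exact O.le_opNorm _
    _ = _ := by ring

theorem opTrace_mul_add_left {P Q : H →L[ℂ] H} (hP : P.IsPositive) (hPT : positiveTrace P ≠ ⊤)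
    (hQ : Q.IsPositive) (hQT : positiveTrace Q ≠ ⊤) (O : H →L[ℂ] H) :
    opTrace ((P + Q) * O) = opTrace (P * O) + opTrace (Q * O) := by
  refine HasSum.tsum_eq ?_
  convert (hasSum_opTrace_mul hP hPT O).add (hasSum_opTrace_mul hQ hQT O) using 2
  rw [add_mul, add_apply, inner_add_right]

theorem opTrace_mul_sum_right {P : H →L[ℂ] H} (hP : P.IsPositive) (hPT : positiveTrace P ≠ ⊤)
    (s : Finset ι) (z : ι → ℂ) (O : ι → H →L[ℂ] H) :
    opTrace (P * ∑ i ∈ s, z i • O i) = ∑ i ∈ s, z i * opTrace (P * O i) := by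
  have h := hasSum_sum (s := s) fun i _ => (hasSum_opTrace_mul hP hPT (O i)).mul_left (z i)
  rw [opTrace, ← h.tsum_eq]
  congr 1
  funext j
  simp only [Finset.mul_sum, sum_apply, inner_sum, mul_smul_comm, smul_apply, inner_smul_right]

theorem positiveTrace_add {P Q : H →L[ℂ] H} (hP : P.IsPositive) (hQ : Q.IsPositive) :
    positiveTrace (P + Q) = positiveTrace P + positiveTrace Q := by
  rw [positiveTrace, positiveTrace, positiveTrace, ← ENNReal.tsum_add]
  congr 1
  ext i
  rw [add_apply, inner_add_right, Complex.add_re, ENNReal.ofReal_add]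
  · exact hP.re_inner_nonneg_right _
  · exact hQ.re_inner_nonneg_right _

theorem positiveTrace_smul (P : H →L[ℂ] H) {a : ℝ} (ha : 0 ≤ a) :
    positiveTrace (a • P) = ENNReal.ofReal a * positiveTrace P := by
  rw [positiveTrace, positiveTrace, ← ENNReal.tsum_mul_left]
  congr 1
  ext i
  rw [smul_apply, ← ENNReal.ofReal_mul ha, inner_smul_right_eq_smul]
  simp

/-- Hölder's inequality for the difference of two positive trace class operators. -/
theorem norm_opTrace_sub_le {P Q : H →L[ℂ] H} (hP : P.IsPositive) (hPT : positiveTrace P ≠ ⊤)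
    (hQ : Q.IsPositive) (hQT : positiveTrace Q ≠ ⊤) (hPQ : traceNorm (P - Q) ≠ ⊤)
    (O : H →L[ℂ] H) :
    ‖opTrace (P * O) - opTrace (Q * O)‖ ≤ (traceNorm (P - Q)).toReal * ‖O‖ := by
  set T := P - Q with hTdef
  have hsa : IsSelfAdjoint T := hP.isSelfAdjoint.sub hQ.isSelfAdjoint
  have hpos : (T⁺).IsPositive := (T⁺).nonneg_iff_isPositive.1 (CFC.posPart_nonneg T)
  have hneg : (T⁻).IsPositive := (T⁻).nonneg_iff_isPositive.1 (CFC.negPart_nonneg T)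
  have hadd : traceNorm T = positiveTrace T⁺ + positiveTrace T⁻ := by
    rw [traceNorm, ← CFC.posPart_add_negPart T hsa, positiveTrace_add hpos hneg]
  rw [hadd] at hPQ ⊢
  obtain ⟨h1, h2⟩ := ENNReal.add_ne_top.1 hPQ
  -- P - Q = T⁺ - T⁻, rearranged so that both sides are sums of positive trace class operators;
  -- additivity of the trace is available only for those.
  have hdec : P + T⁻ = Q + T⁺ := by
    have := CFC.posPart_sub_negPart T hsa
    rw [← sub_eq_zero] at this ⊢
    rw [← neg_eq_zero, ← this, hTdef]
    abel
  have e1 := opTrace_mul_add_left hP hPT hneg h2 O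
  rw [hdec, opTrace_mul_add_left hQ hQT hpos h1 O] at e1
  have e2 : opTrace (P * O) - opTrace (Q * O) = opTrace (T⁺ * O) - opTrace (T⁻ * O) := by
    linear_combination -e1
  rw [e2, ENNReal.toReal_add h1 h2, add_mul]
  exact (norm_sub_le _ _).trans
    (add_le_add (norm_opTrace_mul_le hpos h1 O) (norm_opTrace_mul_le hneg h2 O))

theorem traceNorm_zero : traceNorm (0 : H →L[ℂ] H) = 0 := by
  simp [traceNorm, positiveTrace]

/-- A self-adjoint operator is dominated by a positive operator whose trace is its trace norm. -/
theorem exists_isPositive_ge {T : H →L[ℂ] H} (hT : IsSelfAdjoint T) :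
    ∃ A : H →L[ℂ] H, A.IsPositive ∧ positiveTrace A = traceNorm T ∧
      ∀ x, (inner ℂ x (T x)).re ≤ (inner ℂ x (A x)).re := by
  refine ⟨CFC.abs T, (CFC.abs T).nonneg_iff_isPositive.1 (CFC.abs_nonneg T), rfl, fun x => ?_⟩
  have hneg : (T⁻).IsPositive := (T⁻).nonneg_iff_isPositive.1 (CFC.negPart_nonneg T)
  have h1 := CFC.posPart_sub_negPart T hT
  have h2 := CFC.posPart_add_negPart T hT
  -- |T| = T + 2T⁻, so |T| - T is positive.
  have h3 : CFC.abs T = T + T⁻ + T⁻ := by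
    rw [← h2]; nth_rewrite 3 [← h1]; abel
  have h4 : 0 ≤ (inner ℂ x (T⁻ x)).re := hneg.re_inner_nonneg_right x
  rw [h3]
  simp only [add_apply, inner_add_right, Complex.add_re]
  linarith

theorem norm_sum_smul_le (s : Finset ι) (z : ι → ℂ) {T : ι → H →L[ℂ] H} (hT : ∀ i, ‖T i‖ ≤ 1) :
    ‖∑ i ∈ s, z i • T i‖ ≤ ∑ i ∈ s, ‖z i‖ :=
  (norm_sum_le _ _).trans (Finset.sum_le_sum fun i _ => by
    rw [norm_smul]
    exact mul_le_of_le_one_right (norm_nonneg _) (hT i))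

theorem opTrace_adjoint {P : H →L[ℂ] H} (hP : P.IsPositive) (hT : positiveTrace P ≠ ⊤)
    (O : H →L[ℂ] H) : opTrace (P * O.adjoint) = starRingEnd ℂ (opTrace (P * O)) := by
  rw [opTrace_mul_eq hP hT, opTrace_mul_eq hP hT, Complex.conj_tsum]
  congr 1
  ext n
  rw [ContinuousLinearMap.adjoint_inner_right, inner_conj_symm]

end Trace

/-! ### The tensor product of two mode spaces -/

section Tensor

variable {m : ℕ} {ι κ : Type*}

/-- The product vector as a bounded bilinear map. -/
def productVectorL (m : ℕ) : ModeSpace m →L[ℂ] ModeSpace m →L[ℂ] Bipartite m :=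
  (ContinuousLinearMap.compL ℂ (ModeSpace m) (ModeSpace m ⊗[ℂ] ModeSpace m) (Bipartite m)
    UniformSpace.Completion.toComplL) ∘L (TensorProduct.mkL ℂ (ModeSpace m) (ModeSpace m))

theorem productVectorL_apply (f g : ModeSpace m) : productVectorL m f g = productVector f g := rfl

theorem inner_productVector (f g f' g' : ModeSpace m) :
    inner ℂ (productVector f g) (productVector f' g') = inner ℂ f f' * inner ℂ g g' := by
  rw [productVector, productVector, UniformSpace.Completion.inner_coe, TensorProduct.inner_tmul]

theorem norm_productVector (f g : ModeSpace m) : ‖productVector f g‖ = ‖f‖ * ‖g‖ := by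
  rw [productVector, UniformSpace.Completion.norm_coe, TensorProduct.norm_tmul]

theorem dense_span_productVector :
    Dense (Submodule.span ℂ {x : Bipartite m | ∃ f g, productVector f g = x} :
      Set (Bipartite m)) := by
  have h := UniformSpace.Completion.denseRange_coe (α := ModeSpace m ⊗[ℂ] ModeSpace m)
  refine Dense.mono ?_ h
  rintro _ ⟨x, rfl⟩
  induction x using TensorProduct.induction_on with
  | zero => exact Submodule.zero_mem _
  | tmul f g => exact Submodule.subset_span ⟨f, g, rfl⟩
  | add x y hx hy =>
    rw [UniformSpace.Completion.coe_add]
    exact Submodule.add_mem _ hx hy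

theorem ext_productVector {F : Type*} [NormedAddCommGroup F] [NormedSpace ℂ F]
    {S T : Bipartite m →L[ℂ] F} (h : ∀ f g, S (productVector f g) = T (productVector f g)) :
    S = T := by
  refine ContinuousLinearMap.ext_on dense_span_productVector ?_
  rintro _ ⟨f, g, rfl⟩
  exact h f g

theorem ext_inner_productVector {x y : Bipartite m}
    (h : ∀ f g, inner ℂ (productVector f g) x = inner ℂ (productVector f g) y) : x = y := by
  have : innerSL ℂ x = innerSL ℂ y := by
    refine ext_productVector fun f g => ?_
    rw [innerSL_apply_apply, innerSL_apply_apply, ← inner_conj_symm, h, inner_conj_symm]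
  exact (InnerProductSpace.toDualMap ℂ (Bipartite m)).injective this

theorem tensorOp_productVector (S T : ModeSpace m →L[ℂ] ModeSpace m) (f g : ModeSpace m) :
    tensorOp S T (productVector f g) = productVector (S f) (T g) := by
  rw [tensorOp, productVector, ContinuousLinearMap.completion_apply_coe, TensorProduct.mapL_tmul]
  rfl

theorem tensorOp_mul (S S' T T' : ModeSpace m →L[ℂ] ModeSpace m) :
    tensorOp S T * tensorOp S' T' = tensorOp (S * S') (T * T') :=
  ext_productVector fun f g => by
    simp only [mul_apply_eq_comp, tensorOp_productVector]

theorem tensorOp_smul_smul (a b : ℂ) (S T : ModeSpace m →L[ℂ] ModeSpace m) :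
    tensorOp (a • S) (b • T) = (a * b) • tensorOp S T :=
  ext_productVector fun f g => by
    simp only [smul_apply, tensorOp_productVector]
    simp only [← productVectorL_apply, map_smul, smul_apply, smul_smul, mul_comm]

theorem adjoint_tensorOp (S T : ModeSpace m →L[ℂ] ModeSpace m) :
    (tensorOp S T).adjoint = tensorOp S.adjoint T.adjoint := by
  refine ext_productVector fun f g => ext_inner_productVector fun f' g' => ?_
  rw [ContinuousLinearMap.adjoint_inner_right, tensorOp_productVector, tensorOp_productVector,
    inner_productVector, inner_productVector, ContinuousLinearMap.adjoint_inner_right,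
    ContinuousLinearMap.adjoint_inner_right]

theorem norm_tensorOp_le (S T : ModeSpace m →L[ℂ] ModeSpace m) :
    ‖tensorOp S T‖ ≤ ‖S‖ * ‖T‖ := by
  refine ContinuousLinearMap.opNorm_le_bound _ (by positivity) fun x => ?_
  induction x using UniformSpace.Completion.induction_on with
  | hp => exact isClosed_le (by fun_prop) (by fun_prop)
  | ih x =>
    rw [tensorOp, ContinuousLinearMap.completion_apply_coe, UniformSpace.Completion.norm_coe,
      UniformSpace.Completion.norm_coe]
    exact (ContinuousLinearMap.le_opNorm _ _).trans
      (mul_le_mul_of_nonneg_right (TensorProduct.norm_mapL_le S T) (norm_nonneg _))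

theorem orthonormal_productVector {b : ι → ModeSpace m} {b' : κ → ModeSpace m}
    (hb : Orthonormal ℂ b) (hb' : Orthonormal ℂ b') :
    Orthonormal ℂ fun p : ι × κ => productVector (b p.1) (b' p.2) := by
  have h := (hb.tmul hb').comp_linearIsometry
    (UniformSpace.Completion.toComplₗᵢ (𝕜 := ℂ) (E := ModeSpace m ⊗[ℂ] ModeSpace m))
  exact h

/-- The product of two orthonormal bases. -/
def productBasis (b : HilbertBasis ι ℂ (ModeSpace m)) (b' : HilbertBasis κ ℂ (ModeSpace m)) :
    HilbertBasis (ι × κ) ℂ (Bipartite m) :=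
  HilbertBasis.mkOfOrthogonalEqBot (orthonormal_productVector b.orthonormal b'.orthonormal) (by
    rw [Submodule.eq_bot_iff]
    intro x hx
    have hx' : ∀ i j, inner ℂ (productVector (b i) (b' j)) x = 0 := fun i j =>
      (Submodule.mem_orthogonal _ _).1 hx _ (Submodule.subset_span ⟨(i, j), rfl⟩)
    -- The partial inner product of `x` with `b i` has vanishing coordinates in `b'`, which frees
    -- the second factor; the same argument in `b` then frees the first.
    have h1 : ∀ i g, inner ℂ (productVector (b i) g) x = 0 := fun i g => by
      have : (productVectorL m (b i)).adjoint x = 0 := by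
        refine b'.repr.injective ?_
        ext j
        rw [HilbertBasis.repr_apply_apply, ContinuousLinearMap.adjoint_inner_right,
          productVectorL_apply, hx']
        simp
      rw [← productVectorL_apply, ← ContinuousLinearMap.adjoint_inner_right, this, inner_zero_right]
    refine ext_inner_productVector fun f g => ?_
    have : ((productVectorL m).flip g).adjoint x = 0 := by
      refine b.repr.injective ?_
      ext j
      rw [HilbertBasis.repr_apply_apply, ContinuousLinearMap.adjoint_inner_right,
        ContinuousLinearMap.flip_apply, productVectorL_apply, h1]
      simp
    rw [← productVectorL_apply, ← ContinuousLinearMap.flip_apply,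
      ← ContinuousLinearMap.adjoint_inner_right, this, inner_zero_right, inner_zero_right])

theorem productBasis_apply (b : HilbertBasis ι ℂ (ModeSpace m))
    (b' : HilbertBasis κ ℂ (ModeSpace m)) (p : ι × κ) :
    productBasis b b' p = productVector (b p.1) (b' p.2) := by
  rw [productBasis, HilbertBasis.coe_mkOfOrthogonalEqBot]

theorem isPositive_tensorOp {S T : ModeSpace m →L[ℂ] ModeSpace m} (hS : S.IsPositive)
    (hT : T.IsPositive) : (tensorOp S T).IsPositive := by
  obtain ⟨A, hA, rfl⟩ := exists_selfAdjoint_mul_self hS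
  obtain ⟨B, hB, rfl⟩ := exists_selfAdjoint_mul_self hT
  have h : tensorOp (A * A) (B * B) = (tensorOp A B).adjoint ∘L tensorOp A B := by
    rw [adjoint_tensorOp, hA, hB]
    exact (tensorOp_mul A A B B).symm
  rw [h]
  exact ContinuousLinearMap.isPositive_adjoint_comp_self _

/-- With S = A² and T = B², the trace is the Hilbert–Schmidt sum of A ⊗ B. It may be computed in a
product basis, where it factorises. -/
theorem positiveTrace_tensorOp {S T : ModeSpace m →L[ℂ] ModeSpace m} (hS : S.IsPositive)
    (hT : T.IsPositive) : positiveTrace (tensorOp S T) = positiveTrace S * positiveTrace T := by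
  obtain ⟨A, hA, rfl⟩ := exists_selfAdjoint_mul_self hS
  obtain ⟨B, hB, rfl⟩ := exists_selfAdjoint_mul_self hT
  have h : tensorOp (A * A) (B * B) = (tensorOp A B).adjoint * tensorOp A B := by
    rw [adjoint_tensorOp, hA, hB]
    exact (tensorOp_mul A A B B).symm
  have hA' := positiveTrace_adjoint_mul_self A
  have hB' := positiveTrace_adjoint_mul_self B
  rw [hA] at hA'
  rw [hB] at hB'
  rw [h, positiveTrace_adjoint_mul_self,
    tsum_sq_enorm_adjoint _ (productBasis (basis (ModeSpace m)) (basis (ModeSpace m))),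
    adjoint_tensorOp, hA, hB, hA', hB', ENNReal.tsum_prod', ← ENNReal.tsum_mul_right]
  congr 1
  ext i
  rw [← ENNReal.tsum_mul_left]
  congr 1
  ext j
  rw [productBasis_apply, tensorOp_productVector, ← ofReal_norm, norm_productVector,
    ENNReal.ofReal_mul (norm_nonneg _), ofReal_norm, ofReal_norm, mul_pow]

end Tensor

/-! ### Complex conjugation and the partial transpose -/

section Transpose

variable {m : ℕ} {ι : Type*}

theorem inner_star_star (f g : ModeSpace m) : inner ℂ (star f) (star g) = inner ℂ g f := by
  rw [L2.inner_def, L2.inner_def]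
  refine integral_congr_ae ?_
  filter_upwards [Lp.coeFn_star f, Lp.coeFn_star g] with x hf hg
  rw [hf, hg, Pi.star_apply, Pi.star_apply]
  simp [mul_comm]

theorem star_add_modeSpace (f g : ModeSpace m) : star (f + g) = star f + star g := by
  refine Lp.ext ?_
  filter_upwards [Lp.coeFn_star (f + g), Lp.coeFn_star f, Lp.coeFn_star g, Lp.coeFn_add f g,
    Lp.coeFn_add (star f) (star g)] with x h1 h2 h3 h4 h5
  rw [h1, h5, Pi.add_apply, h2, h3, Pi.star_apply, h4, Pi.add_apply, star_add]
  rfl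

theorem star_smul_modeSpace (c : ℂ) (f : ModeSpace m) :
    star (c • f) = starRingEnd ℂ c • star f := by
  refine Lp.ext ?_
  filter_upwards [Lp.coeFn_star (c • f), Lp.coeFn_star f, Lp.coeFn_smul c f,
    Lp.coeFn_smul (starRingEnd ℂ c) (star f)] with x h1 h2 h3 h4
  rw [h1, h4, Pi.smul_apply, h2, Pi.star_apply, h3, Pi.smul_apply, smul_eq_mul, star_mul']
  rfl

theorem norm_star_modeSpace (f : ModeSpace m) : ‖star f‖ = ‖f‖ := by
  have h := inner_star_star f f
  rw [inner_self_eq_norm_sq_to_K, inner_self_eq_norm_sq_to_K] at h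
  have h' : ‖star f‖ ^ 2 = ‖f‖ ^ 2 := by exact_mod_cast h
  exact (pow_left_inj₀ (norm_nonneg _) (norm_nonneg _) two_ne_zero).1 h'

theorem orthonormal_star {b : ι → ModeSpace m} (hb : Orthonormal ℂ b) :
    Orthonormal ℂ fun i => star (b i) := by
  refine ⟨fun i => by rw [norm_star_modeSpace, hb.1 i], fun i j hij => ?_⟩
  change inner ℂ _ _ = _
  rw [inner_star_star]
  exact hb.2 hij.symm

/-- The operator `g ↦ (T g*)*`. -/
def conjOp (T : ModeSpace m →L[ℂ] ModeSpace m) : ModeSpace m →L[ℂ] ModeSpace m :=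
  LinearMap.mkContinuous
    { toFun := fun g => star (T (star g))
      map_add' := fun f g => by simp only [star_add_modeSpace, map_add]
      map_smul' := fun c f => by simp [star_smul_modeSpace] } ‖T‖ fun g => by
    change ‖star (T (star g))‖ ≤ _
    rw [norm_star_modeSpace, ← norm_star_modeSpace g]
    exact T.le_opNorm _

theorem conjOp_apply (T : ModeSpace m →L[ℂ] ModeSpace m) (g : ModeSpace m) :
    conjOp T g = star (T (star g)) := rfl

theorem inner_conjOp (T : ModeSpace m →L[ℂ] ModeSpace m) (f g : ModeSpace m) :
    inner ℂ f (conjOp T g) = inner ℂ (T (star g)) (star f) := by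
  rw [conjOp_apply, ← inner_star_star, star_star]

theorem isPositive_conjOp {T : ModeSpace m →L[ℂ] ModeSpace m} (hT : T.IsPositive) :
    (conjOp T).IsPositive := by
  rw [ContinuousLinearMap.isPositive_iff_complex]
  intro g
  rw [← inner_conj_symm, inner_conjOp, inner_conj_symm]
  have := (T.isPositive_iff_complex.1 hT) (star g)
  rwa [← ContinuousLinearMap.adjoint_inner_left, hT.isSelfAdjoint.adjoint_eq]

/-- The transpose of a self-adjoint operator is its complex conjugate. -/
theorem isPartialTranspose_tensorOp {S T : ModeSpace m →L[ℂ] ModeSpace m} (hT : T.IsPositive) :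
    IsPartialTranspose (tensorOp S T) (tensorOp S (conjOp T)) := by
  intro f f' g g'
  rw [tensorOp_productVector, tensorOp_productVector, inner_productVector, inner_productVector,
    inner_conjOp, ← ContinuousLinearMap.adjoint_inner_right, hT.isSelfAdjoint.adjoint_eq]

theorem isSelfAdjoint_of_isPartialTranspose {T S : Bipartite m →L[ℂ] Bipartite m}
    (hT : IsSelfAdjoint T) (h : IsPartialTranspose T S) : IsSelfAdjoint S := by
  rw [ContinuousLinearMap.isSelfAdjoint_iff']
  refine ext_productVector fun f g => ext_inner_productVector fun f' g' => ?_
  rw [ContinuousLinearMap.adjoint_inner_right, ← inner_conj_symm, h, h, inner_conj_symm,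
    ← ContinuousLinearMap.adjoint_inner_right, hT.adjoint_eq]

/-- The exchange of the two parties. -/
def swapOp (m : ℕ) : Bipartite m →L[ℂ] Bipartite m :=
  ContinuousLinearMap.completion (LinearIsometry.toContinuousLinearMap
    (TensorProduct.commIsometry ℂ (ModeSpace m) (ModeSpace m)).toLinearIsometry)

theorem swapOp_productVector (f g : ModeSpace m) :
    swapOp m (productVector f g) = productVector g f := by
  rw [swapOp, productVector, ContinuousLinearMap.completion_apply_coe]
  rfl

/-- The operator `R` of a vector `φ` with `⟨f, R g⟩ = ⟨f ⊗ g*, φ⟩`. -/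
def vecOp (φ : Bipartite m) : ModeSpace m →L[ℂ] ModeSpace m :=
  LinearMap.mkContinuous
    { toFun := fun g => ((productVectorL m).flip (star g)).adjoint φ
      map_add' := fun f g => by simp only [star_add_modeSpace, map_add, add_apply]
      map_smul' := fun c f => by
        simp only [star_smul_modeSpace, map_smul, map_smulₛₗ, RingHom.id_apply,
          Complex.conj_conj, smul_apply] } ‖φ‖ fun g => by
    change ‖((productVectorL m).flip (star g)).adjoint φ‖ ≤ _
    refine (ContinuousLinearMap.le_opNorm _ _).trans ?_
    rw [LinearIsometryEquiv.norm_map, mul_comm]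
    gcongr
    refine ContinuousLinearMap.opNorm_le_bound _ (norm_nonneg _) fun f => ?_
    rw [ContinuousLinearMap.flip_apply, productVectorL_apply, norm_productVector,
      norm_star_modeSpace, mul_comm]

theorem inner_vecOp (φ : Bipartite m) (f g : ModeSpace m) :
    inner ℂ f (vecOp φ g) = inner ℂ (productVector f (star g)) φ := by
  change inner ℂ f (((productVectorL m).flip (star g)).adjoint φ) = _
  rw [ContinuousLinearMap.adjoint_inner_right]
  rfl

theorem norm_vecOp_le (φ : Bipartite m) : ‖vecOp φ‖ ≤ ‖φ‖ :=
  LinearMap.mkContinuous_norm_le _ (norm_nonneg _) _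

theorem exists_hasSum_inner_apply {H : Type*} [NormedAddCommGroup H] [InnerProductSpace ℂ H]
    [CompleteSpace H] {R : ι → H →L[ℂ] H} {r : ι → ℝ} (hr : Summable r) (hR : ∀ i, ‖R i‖ ≤ r i) :
    ∃ S : H →L[ℂ] H, ∀ x y, HasSum (fun i => inner ℂ x (R i y)) (inner ℂ x (S y)) :=
  ⟨∑' i, R i, fun x y => ((Summable.of_norm_bounded hr hR).hasSum.mapL
    (ContinuousLinearMap.apply ℂ H y)).mapL (innerSL ℂ x)⟩

/-- For P = |φ⟩⟨φ| and R = `vecOp φ` the partial transpose is (R ⊗ R†) composed with the exchange of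
the parties, of norm at most ‖φ‖² ‖`swapOp m`‖. For general P these operators, with φ = √P eᵢ, sum
absolutely in operator norm because ∑ᵢ ‖√P eᵢ‖² = tr P. -/
theorem exists_isPartialTranspose {P : Bipartite m →L[ℂ] Bipartite m} (hP : P.IsPositive)
    (hT : positiveTrace P ≠ ⊤) : ∃ S, IsPartialTranspose P S := by
  have hR : ∀ i, ‖tensorOp (vecOp (sqrtVec P i)) (vecOp (sqrtVec P i)).adjoint ∘L swapOp m‖ ≤
      ‖sqrtVec P i‖ ^ 2 * ‖swapOp m‖ := fun i => by
    refine (ContinuousLinearMap.opNorm_comp_le _ _).trans ?_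
    refine mul_le_mul_of_nonneg_right ((norm_tensorOp_le _ _).trans ?_) (norm_nonneg _)
    rw [LinearIsometryEquiv.norm_map, ← sq]
    exact pow_le_pow_left₀ (norm_nonneg _) (norm_vecOp_le _) 2
  obtain ⟨S, hS⟩ := exists_hasSum_inner_apply
    ((summable_sq_norm_sqrtVec hP hT).mul_right ‖swapOp m‖) hR
  refine ⟨S, fun f f' g g' => ?_⟩
  have h1 := hS (productVector f g) (productVector f' g')
  have h2 := hasSum_inner_sqrtVec hP (productVector f (star g')) (productVector f' (star g))
  rw [← h1.tsum_eq, ← h2.tsum_eq]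
  congr 1
  funext i
  rw [ContinuousLinearMap.comp_apply, swapOp_productVector, tensorOp_productVector,
    inner_productVector, inner_vecOp, ContinuousLinearMap.adjoint_inner_right,
    ← inner_conj_symm (vecOp _ g), inner_vecOp, inner_conj_symm]

theorem isPartialTranspose_partialTranspose {P : Bipartite m →L[ℂ] Bipartite m}
    (hP : P.IsPositive) (hT : positiveTrace P ≠ ⊤) :
    IsPartialTranspose P (partialTranspose P) := by
  have h := exists_isPartialTranspose hP hT
  rw [partialTranspose, dif_pos h]
  exact h.choose_spec

/-- Positive trace class operators with a positive partial transpose. -/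
def positivePT (m : ℕ) : Set (Bipartite m →L[ℂ] Bipartite m) :=
  {τ | τ.IsPositive ∧ positiveTrace τ ≠ ⊤ ∧ ∃ S, S.IsPositive ∧ IsPartialTranspose τ S}

theorem convex_positivePT : Convex ℝ (positivePT m) := by
  rintro P ⟨hP, hPT, S, hS, hPS⟩ Q ⟨hQ, hQT, S', hS', hQS⟩ a b ha hb -
  have hpos : ∀ {T : Bipartite m →L[ℂ] Bipartite m} {c : ℝ}, T.IsPositive → 0 ≤ c →
      (c • T).IsPositive := fun {T c} hT hc => by
    have := hT.smul_of_nonneg (c := (c : ℂ)) (by exact_mod_cast hc)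
    rwa [Complex.coe_smul] at this
  have hinner : ∀ (T T' : Bipartite m →L[ℂ] Bipartite m) (x y : Bipartite m),
      inner ℂ x ((a • T + b • T') y) = a * inner ℂ x (T y) + b * inner ℂ x (T' y) := by
    intro T T' x y
    rw [add_apply, smul_apply, smul_apply, inner_add_right, inner_smul_right_eq_smul,
      inner_smul_right_eq_smul]
    simp
  refine ⟨(hpos hP ha).add (hpos hQ hb), ?_, a • S + b • S', (hpos hS ha).add (hpos hS' hb), ?_⟩
  · rw [positiveTrace_add (hpos hP ha) (hpos hQ hb), positiveTrace_smul _ ha,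
      positiveTrace_smul _ hb]
    exact ENNReal.add_ne_top.2 ⟨ENNReal.mul_ne_top ENNReal.ofReal_ne_top hPT,
      ENNReal.mul_ne_top ENNReal.ofReal_ne_top hQT⟩
  · intro f f' g g'
    rw [hinner, hinner, hPS, hQS]

theorem productStates_subset_positivePT : productStates m ⊆ positivePT m := by
  rintro _ ⟨ρA, ρB, ⟨hA, hA'⟩, ⟨hB, hB'⟩, rfl⟩
  refine ⟨isPositive_tensorOp hA hB, ?_, tensorOp ρA (conjOp ρB),
    isPositive_tensorOp hA (isPositive_conjOp hB), isPartialTranspose_tensorOp hB⟩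
  rw [positiveTrace_tensorOp hA hB, hA', hB']
  simp

end Transpose

/-! ### The Weyl relations -/

section Displacement

variable {m : ℕ}

theorem coeFn_displacement (ξ : Fin m → ℂ) (f : ModeSpace m) :
    displacement ξ f =ᵐ[volume] displaceFun ξ f :=
  (memLp_displaceFun ξ f).coeFn_toLp

theorem norm_displacement_apply (ξ : Fin m → ℂ) (f : ModeSpace m) : ‖displacement ξ f‖ = ‖f‖ := by
  change ‖(memLp_displaceFun ξ f).toLp (displaceFun ξ f)‖ = ‖f‖
  rw [Lp.norm_toLp, eLpNorm_displaceFun, Lp.norm_def]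

theorem norm_displacement_le (ξ : Fin m → ℂ) : ‖displacement ξ‖ ≤ 1 :=
  ContinuousLinearMap.opNorm_le_bound _ zero_le_one fun f => by
    rw [norm_displacement_apply, one_mul]

theorem displaceFun_congr_ae (ξ : Fin m → ℂ) {f g : (Fin m → ℝ) → ℂ} (h : f =ᵐ[volume] g) :
    displaceFun ξ f =ᵐ[volume] displaceFun ξ g := by
  filter_upwards [(measurePreserving_shift ξ).quasiMeasurePreserving.ae h] with x hx
  simp only [displaceFun]
  rw [hx]

theorem displacement_mul (ξ η : Fin m → ℂ) :
    displacement ξ * displacement η =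
      Complex.exp (Complex.I * ((∑ k, (ξ k * starRingEnd ℂ (η k)).im : ℝ) : ℂ)) •
        displacement (ξ + η) := by
  ext1 f
  refine Lp.ext ?_
  rw [smul_apply, mul_apply_eq_comp]
  filter_upwards [coeFn_displacement ξ (displacement η f), coeFn_displacement (ξ + η) f,
    displaceFun_congr_ae ξ (coeFn_displacement η f),
    Lp.coeFn_smul (Complex.exp (Complex.I * ((∑ k, (ξ k * starRingEnd ℂ (η k)).im : ℝ) : ℂ)))
      (displacement (ξ + η) f)] with x h1 h2 h3 h4
  rw [h1, h3, h4, Pi.smul_apply, h2, smul_eq_mul]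
  simp only [displaceFun, ← mul_assoc, ← Complex.exp_add, ← mul_add, ← Complex.ofReal_add,
    ← Finset.sum_add_distrib]
  congr 1
  · congr 3
    refine Finset.sum_congr rfl fun k _ => ?_
    simp only [Pi.add_apply, Complex.add_re, Complex.add_im, Complex.mul_im, Complex.conj_re,
      Complex.conj_im]
    have : √2 * √2 = (2 : ℝ) := Real.mul_self_sqrt zero_le_two
    -- The shift by √2 Re ξ acts on the phase √2 Im η x of the inner displacement and produces -2 Re
    -- ξ Im η.
    linear_combination (-(η k).im * (ξ k).re) * this
  · congr 1
    ext k
    simp only [Pi.add_apply, Complex.add_re]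
    ring

theorem displacement_zero : displacement (0 : Fin m → ℂ) = 1 := by
  ext1 f
  refine Lp.ext ?_
  filter_upwards [coeFn_displacement 0 f] with x hx
  rw [hx]
  simp [displaceFun]

theorem displacement_mul_neg (ξ : Fin m → ℂ) : displacement ξ * displacement (-ξ) = 1 := by
  rw [displacement_mul, add_neg_cancel, displacement_zero]
  have : ∑ k, (ξ k * starRingEnd ℂ ((-ξ) k)).im = 0 :=
    Finset.sum_eq_zero fun k _ => by
      simp [mul_comm]
  rw [this]
  simp

/-- D(ξ) is an isometry, so D(ξ)† is a left inverse; D(-ξ) is a right inverse, hence they agree. -/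
theorem adjoint_displacement (ξ : Fin m → ℂ) : (displacement ξ).adjoint = displacement (-ξ) := by
  have h1 : (displacement ξ).adjoint * displacement ξ = 1 :=
    (ContinuousLinearMap.norm_map_iff_adjoint_comp_self _).1 (norm_displacement_apply ξ)
  calc (displacement ξ).adjoint
      = (displacement ξ).adjoint * (displacement ξ * displacement (-ξ)) := by
        rw [displacement_mul_neg, mul_one]
    _ = displacement (-ξ) := by rw [← mul_assoc, h1, one_mul]

theorem star_displacement (ξ : Fin m → ℂ) (f : ModeSpace m) :
    star (displacement ξ f) = displacement (star ξ) (star f) := by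
  refine Lp.ext ?_
  filter_upwards [coeFn_displacement ξ f, coeFn_displacement (star ξ) (star f),
    displaceFun_congr_ae (star ξ) (Lp.coeFn_star f), Lp.coeFn_star (displacement ξ f)]
    with x h1 h2 h3 h4
  rw [h4, h2, h3, Pi.star_apply, h1]
  simp only [displaceFun, star_mul', Pi.star_apply]
  congr 1
  · rw [RCLike.star_def, ← Complex.exp_conj, map_mul, Complex.conj_I, Complex.conj_ofReal,
      neg_mul, ← mul_neg, ← Complex.ofReal_neg, ← Finset.sum_neg_distrib]
    congr 3
    refine Finset.sum_congr rfl fun k _ => ?_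
    simp
    ring

/-- Used for A; for B the adjoint stands on the left (`displacement_sub_right`) and the phase is the
opposite one, so the two cancel. -/
theorem displacement_sub_left (ξ η : Fin m → ℂ) :
    displacement ξ * (displacement η).adjoint =
      Complex.exp (Complex.I * ((-∑ k, (ξ k * starRingEnd ℂ (η k)).im : ℝ) : ℂ)) •
        displacement (ξ - η) := by
  rw [adjoint_displacement, displacement_mul, ← sub_eq_add_neg, ← Finset.sum_neg_distrib]
  simp

theorem displacement_sub_right (ξ η : Fin m → ℂ) :
    (displacement η).adjoint * displacement ξ =
      Complex.exp (Complex.I * ((∑ k, (ξ k * starRingEnd ℂ (η k)).im : ℝ) : ℂ)) •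
        displacement (ξ - η) := by
  rw [adjoint_displacement, displacement_mul, neg_add_eq_sub]
  congr 4
  refine Finset.sum_congr rfl fun k _ => ?_
  simp
  ring

theorem coeFn_parity (f : ModeSpace m) : parity m f =ᵐ[volume] fun x => f (-x) :=
  Lp.coeFn_compMeasurePreserving f (Measure.measurePreserving_neg volume)

theorem parity_mul_displacement (ξ : Fin m → ℂ) :
    parity m * displacement ξ = displacement (-ξ) * parity m := by
  ext1 f
  refine Lp.ext ?_
  rw [mul_apply_eq_comp, mul_apply_eq_comp]
  filter_upwards [coeFn_parity (displacement ξ f), coeFn_displacement (-ξ) (parity m f),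
    (Measure.measurePreserving_neg volume).quasiMeasurePreserving.ae (coeFn_displacement ξ f),
    displaceFun_congr_ae (-ξ) (coeFn_parity f)] with x h1 h2 h3 h4
  rw [h1, h2, h4, h3]
  simp only [displaceFun]
  congr 1
  · simp
  · congr 1
    ext k
    simp
    ring

/-- Moving Π to the right turns D(α)† = D(-α) into D(α), and D(α)² carries no phase. Facts about
displaced parities thus follow from those about displacements. -/
theorem displacedParity_eq (α : Fin m → ℂ) :
    displacedParity α = displacement (2 • α) * parity m := by
  rw [displacedParity, adjoint_displacement, mul_assoc, parity_mul_displacement, neg_neg,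
    ← mul_assoc, displacement_mul, two_nsmul]
  have : ∑ k, (α k * starRingEnd ℂ (α k)).im = 0 :=
    Finset.sum_eq_zero fun k _ => by rw [Complex.mul_conj, Complex.ofReal_im]
  rw [this]
  simp

theorem norm_parity_apply (f : ModeSpace m) : ‖parity m f‖ = ‖f‖ := LinearIsometry.norm_map _ f

theorem norm_displacedParity_apply (α : Fin m → ℂ) (f : ModeSpace m) :
    ‖displacedParity α f‖ = ‖f‖ := by
  rw [displacedParity_eq, mul_apply_eq_comp, norm_displacement_apply, norm_parity_apply]

/-- Two parties whose displacements have the same symplectic products. -/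
theorem tensorOp_displacement_sub {ξ η ξ' η' : Fin m → ℂ}
    (h : ∑ k, (ξ k * starRingEnd ℂ (η k)).im = ∑ k, (ξ' k * starRingEnd ℂ (η' k)).im) :
    displacementA (ξ - η) * displacementB (ξ' - η') =
      tensorOp (displacement ξ) (displacement η').adjoint *
        (tensorOp (displacement η) (displacement ξ').adjoint).adjoint := by
  rw [adjoint_tensorOp, ContinuousLinearMap.adjoint_adjoint, displacementA, displacementB,
    tensorOp_mul, tensorOp_mul, displacement_sub_left, displacement_sub_right,
    tensorOp_smul_smul, ← Complex.exp_add, ← mul_add, ← Complex.ofReal_add, h, neg_add_cancel]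
  simp

end Displacement

/-! ### Strong continuity -/

section Continuity

variable {m : ℕ} {H X : Type*} [NormedAddCommGroup H] [InnerProductSpace ℂ H] [TopologicalSpace X]

/-- At constant norm, weak continuity is strong continuity: ‖F x - F x₀‖² = 2r² - 2 Re ⟨F x₀, F x⟩.
-/
theorem continuous_of_continuous_inner {F : X → H} {r : ℝ} (hr : ∀ x, ‖F x‖ = r)
    (h : ∀ y, Continuous fun x => inner ℂ y (F x)) : Continuous F := by
  rw [continuous_iff_continuousAt]
  intro x₀
  rw [ContinuousAt, tendsto_iff_norm_sub_tendsto_zero]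
  have h1 : Continuous fun x => √(2 * r ^ 2 - 2 * (inner ℂ (F x₀) (F x)).re) := by
    have := h (F x₀)
    fun_prop
  have h2 : ∀ x, ‖F x - F x₀‖ = √(2 * r ^ 2 - 2 * (inner ℂ (F x₀) (F x)).re) := fun x => by
    rw [eq_comm, Real.sqrt_eq_iff_eq_sq _ (norm_nonneg _), norm_sub_rev, @norm_sub_sq ℂ, hr, hr]
    · simp only [RCLike.re_to_complex]
      ring
    · have := re_inner_le_norm (𝕜 := ℂ) (F x₀) (F x)
      rw [hr, hr] at this
      simp only [RCLike.re_to_complex] at this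
      nlinarith
  simp_rw [h2]
  have h3 := h1.tendsto x₀
  rwa [← h2, sub_self, norm_zero] at h3

theorem continuous_apply_of_dense {s : Set H} (hs : Dense (Submodule.span ℂ s : Set H))
    {O : X → H →L[ℂ] H} (hO : ∀ x, ‖O x‖ ≤ 1) (h : ∀ v ∈ s, Continuous fun x => O x v) (v : H) :
    Continuous fun x => O x v := by
  have hspan : ∀ v ∈ Submodule.span ℂ s, Continuous fun x => O x v := by
    intro v hv
    induction hv using Submodule.span_induction with
    | mem v hv => exact h v hv
    | zero => simpa using continuous_const
    | add v w _ _ hv hw => simp only [map_add]; fun_prop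
    | smul c v _ hv => simp only [map_smul]; fun_prop
  refine continuous_of_uniform_approx_of_continuous fun u hu => ?_
  obtain ⟨ε, hε, hεu⟩ := Metric.mem_uniformity_dist.1 hu
  obtain ⟨w, hw, hvw⟩ := Metric.dense_iff.1 hs v ε hε
  refine ⟨fun x => O x w, hspan w hvw, fun x => hεu ?_⟩
  rw [Metric.mem_ball, dist_comm] at hw
  rw [dist_eq_norm, ← map_sub]
  refine lt_of_le_of_lt ((O x).le_of_opNorm_le (hO x) _) ?_
  rwa [one_mul, ← dist_eq_norm]

theorem integrable_inner (f g : ModeSpace m) :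
    Integrable (fun x => inner ℂ (f x) (g x)) (volume : Measure (Fin m → ℝ)) :=
  L2.integrable_inner f g

/-- Imaginary displacements multiply by phases, so their matrix elements are continuous by dominated
convergence. -/
theorem continuous_displacement_im (f : ModeSpace m) :
    Continuous fun y : Fin m → ℝ => displacement (fun k => (y k : ℂ) * Complex.I) f := by
  refine continuous_of_continuous_inner (fun y => norm_displacement_apply _ f) fun g => ?_
  have h : ∀ y : Fin m → ℝ, inner ℂ g (displacement (fun k => (y k : ℂ) * Complex.I) f) =
      ∫ x, Complex.exp (Complex.I * ((∑ k, √2 * y k * x k : ℝ) : ℂ)) * inner ℂ (g x) (f x) := by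
    intro y
    rw [L2.inner_def]
    refine integral_congr_ae ?_
    filter_upwards [coeFn_displacement (fun k => (y k : ℂ) * Complex.I) f] with x hx
    rw [hx]
    simp only [displaceFun]
    simp [mul_assoc]
  simp_rw [h]
  refine continuous_of_dominated (bound := fun x => ‖inner ℂ (g x) (f x)‖) (fun y => ?_)
    (fun y => ?_) (integrable_inner g f).norm ?_
  · exact (Continuous.aestronglyMeasurable (by fun_prop)).mul (integrable_inner g f).1
  · refine Filter.Eventually.of_forall fun x => ?_
    rw [norm_mul, mul_comm Complex.I, Complex.norm_exp_ofReal_mul_I, one_mul]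
  · exact Filter.Eventually.of_forall fun x => by fun_prop

theorem continuous_displacement_re (f : ModeSpace m) :
    Continuous fun y : Fin m → ℝ => displacement (fun k => (y k : ℂ)) f := by
  have hg : Continuous fun y : Fin m → ℝ =>
      (ContinuousMap.mk (fun p : (Fin m → ℝ) × (Fin m → ℝ) => fun k => p.2 k - √2 * p.1 k)
        (by fun_prop)).curry y :=
    ContinuousMap.continuous _
  have h := (continuous_const (y := f)).compMeasurePreservingLp hg
    (fun y => measurePreserving_sub_right volume fun k => √2 * y k) (by simp)
  convert h using 2 with y
  refine Lp.ext ?_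
  filter_upwards [coeFn_displacement (fun k => (y k : ℂ)) f,
    Lp.coeFn_compMeasurePreserving f (measurePreserving_sub_right volume fun k => √2 * y k)]
    with x h1 h2
  rw [h1]
  refine Eq.trans ?_ h2.symm
  simp [displaceFun]
  rfl

theorem displacement_eq_mul (ξ : Fin m → ℂ) :
    displacement ξ = Complex.exp (Complex.I * ((-∑ k, (ξ k).im * (ξ k).re : ℝ) : ℂ)) •
      (displacement (fun k => ((ξ k).im : ℂ) * Complex.I) *
        displacement fun k => ((ξ k).re : ℂ)) := by
  rw [displacement_mul, smul_smul, ← Complex.exp_add, ← mul_add, ← Complex.ofReal_add]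
  have h1 : (fun k => ((ξ k).im : ℂ) * Complex.I) + (fun k => ((ξ k).re : ℂ)) = ξ := by
    ext k
    simp only [Pi.add_apply]
    rw [add_comm, Complex.re_add_im]
  rw [h1]
  simp

/-- D(ξ) is a phase times D(i Im ξ) D(Re ξ). Testing weakly moves the first factor onto the other
vector, so continuity of each factor separately suffices. -/
theorem continuous_displacement (f : ModeSpace m) :
    Continuous fun ξ : Fin m → ℂ => displacement ξ f := by
  refine continuous_of_continuous_inner (fun ξ => norm_displacement_apply ξ f) fun g => ?_
  have h : ∀ ξ : Fin m → ℂ, inner ℂ g (displacement ξ f) =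
      Complex.exp (Complex.I * ((-∑ k, (ξ k).im * (ξ k).re : ℝ) : ℂ)) *
      inner ℂ (displacement (fun k => ((-(ξ k).im : ℝ) : ℂ) * Complex.I) g)
        (displacement (fun k => ((ξ k).re : ℂ)) f) := by
    intro ξ
    rw [displacement_eq_mul, smul_apply, inner_smul_right, mul_apply_eq_comp,
      ← ContinuousLinearMap.adjoint_inner_left, adjoint_displacement]
    congr 4
    ext k
    simp
  simp_rw [h]
  refine Continuous.mul (by fun_prop) (Continuous.inner ?_ ?_)
  · exact (continuous_displacement_im g).comp
      (by fun_prop : Continuous fun (ξ : Fin m → ℂ) k => -(ξ k).im)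
  · exact (continuous_displacement_re f).comp
      (by fun_prop : Continuous fun (ξ : Fin m → ℂ) k => (ξ k).re)

theorem continuous_displacedParity (f : ModeSpace m) :
    Continuous fun α : Fin m → ℂ => displacedParity α f := by
  simp_rw [displacedParity_eq]
  exact (continuous_displacement (parity m f)).comp
    (by fun_prop : Continuous fun α : Fin m → ℂ => 2 • α)

theorem continuous_tensorOp {O O' : (Fin m → ℂ) → ModeSpace m →L[ℂ] ModeSpace m}
    (hO : ∀ α, ‖O α‖ ≤ 1) (hO' : ∀ α, ‖O' α‖ ≤ 1) (h : ∀ f, Continuous fun α => O α f)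
    (h' : ∀ f, Continuous fun α => O' α f) (x : Bipartite m) :
    Continuous fun p : (Fin m → ℂ) × (Fin m → ℂ) => tensorOp (O p.1) (O' p.2) x := by
  refine continuous_apply_of_dense dense_span_productVector (fun p => ?_) ?_ x
  · exact (norm_tensorOp_le _ _).trans (mul_le_one₀ (hO _) (norm_nonneg _) (hO' _))
  · rintro _ ⟨f, g, rfl⟩
    simp_rw [tensorOp_productVector, ← productVectorL_apply]
    exact (((productVectorL m).continuous.comp ((h f).comp continuous_fst))).clm_apply
      ((h' g).comp continuous_snd)

end Continuity

/-! ### Gaussian averages of displacements -/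

section Gaussian

variable {m : ℕ}

theorem measurePreserving_complexPi (m : ℕ) :
    MeasurePreserving
      (fun (α : Fin m → ℂ) => ((fun k => (α k).re : Fin m → ℝ), fun k => (α k).im)) volume
      (volume.prod volume) :=
  (volume_measurePreserving_arrowProdEquivProdArrow ℝ ℝ (Fin m)).comp
    (volume_preserving_pi fun _ => Complex.volume_preserving_equiv_real_prod)

theorem measurableEmbedding_complexPi (m : ℕ) : MeasurableEmbedding
    (fun (α : Fin m → ℂ) => ((fun k => (α k).re : Fin m → ℝ), fun k => (α k).im)) :=
  (MeasurableEquiv.arrowProdEquivProdArrow ℝ ℝ (Fin m)).measurableEmbedding.comp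
    (MeasurableEquiv.piCongrRight fun _ => Complex.measurableEquivRealProd).measurableEmbedding

theorem integral_complexPi {F : (Fin m → ℂ) → ℂ} (hF : Integrable F) :
    ∫ α, F α = ∫ a : Fin m → ℝ, ∫ b : Fin m → ℝ, F fun k => (a k : ℂ) + b k * Complex.I := by
  let F' : (Fin m → ℝ) × (Fin m → ℝ) → ℂ := fun p => F fun k => (p.1 k : ℂ) + p.2 k * Complex.I
  have hcomp : F' ∘
      (fun α : Fin m → ℂ => ((fun k => (α k).re : Fin m → ℝ), fun k => (α k).im)) = F := by
    funext α
    simp [F', Complex.re_add_im]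
  have hF_int : Integrable F' (volume.prod volume) := by
    rw [← (measurePreserving_complexPi m).integrable_comp_emb (measurableEmbedding_complexPi m),
      hcomp]
    exact hF
  have h := (measurePreserving_complexPi m).integral_comp (measurableEmbedding_complexPi m) F'
  rw [← integral_prod _ hF_int, ← h]
  exact congrArg _ hcomp.symm

/-- The Gaussian `exp(-s ∑ₖ |αₖ|² + ∑ₖ (ζₖ αₖ* - ζₖ* αₖ))`. -/
def gaussianWeight (s : ℝ) (ζ α : Fin m → ℂ) : ℂ :=
  Complex.exp (∑ k, (-s * ‖α k‖ ^ 2 + (ζ k * starRingEnd ℂ (α k) - starRingEnd ℂ (ζ k) * α k)))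

theorem continuous_gaussianWeight (s : ℝ) (ζ : Fin m → ℂ) : Continuous (gaussianWeight s ζ) := by
  unfold gaussianWeight
  have := Complex.continuous_conj
  fun_prop

theorem norm_gaussianWeight (s : ℝ) (ζ α : Fin m → ℂ) :
    ‖gaussianWeight s ζ α‖ = ∏ k, Real.exp (-s * ‖α k‖ ^ 2) := by
  rw [gaussianWeight, Complex.norm_exp, Complex.re_sum, Real.exp_sum]
  refine Finset.prod_congr rfl fun k _ => ?_
  congr 1
  rw [Complex.add_re, Complex.sub_re]
  have : (-(s : ℂ) * (‖α k‖ : ℂ) ^ 2).re = -s * ‖α k‖ ^ 2 := by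
    rw [← Complex.ofReal_neg, ← Complex.ofReal_pow, ← Complex.ofReal_mul, Complex.ofReal_re]
  rw [this]
  simp [Complex.mul_re]

theorem integrable_exp_neg_mul_sq_norm {s : ℝ} (hs : 0 < s) :
    Integrable fun z : ℂ => Complex.exp (-s * ‖z‖ ^ 2) := by
  have := GaussianFourier.integrable_cexp_neg_mul_sq_norm_add (b := (s : ℂ)) (V := ℂ)
    (by simpa using hs) 0 0
  simpa using this

theorem integrable_gaussianWeight {s : ℝ} (hs : 0 < s) (ζ : Fin m → ℂ) :
    Integrable (gaussianWeight s ζ) := by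
  have h : Integrable fun α : Fin m → ℂ => ∏ k, Complex.exp (-s * ‖α k‖ ^ 2) :=
    Integrable.fintype_prod (f := fun _ (z : ℂ) => Complex.exp (-s * ‖z‖ ^ 2))
      (fun _ => integrable_exp_neg_mul_sq_norm hs)
  refine h.norm.mono' (continuous_gaussianWeight s ζ).aestronglyMeasurable
    (Filter.Eventually.of_forall fun α => ?_)
  rw [norm_gaussianWeight, norm_prod]
  refine le_of_eq (Finset.prod_congr rfl fun k _ => ?_)
  rw [Complex.norm_exp, ← Complex.ofReal_neg, ← Complex.ofReal_pow, ← Complex.ofReal_mul,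
    Complex.ofReal_re]

theorem integral_gaussianWeight_one :
    ∫ z : Fin m → ℂ, gaussianWeight 1 0 z = (Real.pi : ℂ) ^ m := by
  have h : ∀ z : Fin m → ℂ, gaussianWeight 1 0 z = ∏ k, Complex.exp (-1 * ‖z k‖ ^ 2) := fun z => by
    rw [gaussianWeight, Complex.exp_sum]
    simp
  simp_rw [h]
  rw [integral_fintype_prod_volume_eq_prod (fun _ (z : ℂ) => Complex.exp (-1 * ‖z‖ ^ 2)),
    GaussianFourier.integral_cexp_neg_mul_sq_norm (by simp)]
  simp

/-- The x-integral is at most ‖f‖² + ‖g‖² for every α by translation invariance, and the Gaussian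
handles α. This permits Fubini's theorem in `integral_gaussian_displaceFun`. -/
theorem integrable_gaussian_displaceFun {s : ℝ} (hs : 0 < s) (c : ℝ) (ξ ζ : Fin m → ℂ)
    {f g : (Fin m → ℝ) → ℂ} (hf : StronglyMeasurable f) (hf2 : MemLp f 2 volume)
    (hg : StronglyMeasurable g) (hg2 : MemLp g 2 volume) :
    Integrable (Function.uncurry fun (α : Fin m → ℂ) (x : Fin m → ℝ) =>
      gaussianWeight s ζ α * (starRingEnd ℂ (f x) * displaceFun (ξ + c • α) g x))
      (volume.prod volume) := by
  have hmeas : StronglyMeasurable (Function.uncurry fun (α : Fin m → ℂ) (x : Fin m → ℝ) =>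
      gaussianWeight s ζ α * (starRingEnd ℂ (f x) * displaceFun (ξ + c • α) g x)) := by
    refine StronglyMeasurable.mul
      ((continuous_gaussianWeight s ζ).comp continuous_fst).stronglyMeasurable ?_
    refine StronglyMeasurable.mul
      (Complex.continuous_conj.comp_stronglyMeasurable (hf.comp_measurable measurable_snd)) ?_
    refine StronglyMeasurable.mul (Continuous.stronglyMeasurable (by
      simp only [Pi.add_apply, Pi.smul_apply]
      fun_prop)) ?_
    refine hg.comp_measurable (Continuous.measurable ?_)
    simp only [Pi.add_apply, Pi.smul_apply]
    fun_prop
  have hnf : Integrable fun x => ‖f x‖ ^ 2 := hf2.integrable_norm_pow two_ne_zero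
  have hng : Integrable fun x => ‖g x‖ ^ 2 := hg2.integrable_norm_pow two_ne_zero
  have hshift : ∀ η : Fin m → ℂ,
      Integrable fun x : Fin m → ℝ => ‖g fun k => x k - √2 * (η k).re‖ ^ 2 :=
    fun η => (measurePreserving_shift η).integrable_comp_of_integrable hng
  have hbd : ∀ (η : Fin m → ℂ) x, ‖starRingEnd ℂ (f x) * displaceFun η g x‖ ≤
      ‖f x‖ ^ 2 + ‖g fun k => x k - √2 * (η k).re‖ ^ 2 := fun η x => by
    rw [norm_mul, norm_displaceFun, RCLike.norm_conj]
    nlinarith [sq_nonneg (‖f x‖ - ‖g fun k => x k - √2 * (η k).re‖), sq_nonneg ‖f x‖,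
      sq_nonneg ‖g fun k => x k - √2 * (η k).re‖]
  have hF_int : ∀ α : Fin m → ℂ, Integrable fun x =>
      starRingEnd ℂ (f x) * displaceFun (ξ + c • α) g x := fun α => by
    refine (hnf.add (hshift (ξ + c • α))).mono' ?_ (Filter.Eventually.of_forall (hbd _))
    refine (Complex.continuous_conj.comp_aestronglyMeasurable hf.aestronglyMeasurable).mul
      (((Continuous.stronglyMeasurable (by fun_prop)).mul
        (hg.comp_measurable (measurePreserving_shift _).measurable)).aestronglyMeasurable)
  rw [integrable_prod_iff hmeas.aestronglyMeasurable]
  refine ⟨Filter.Eventually.of_forall fun α => ?_, ?_⟩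
  · simp only [Function.uncurry_apply_pair]
    exact (hF_int α).const_mul _
  refine ((integrable_gaussianWeight hs ζ).norm.mul_const
    ((∫ x, ‖f x‖ ^ 2) + ∫ x, ‖g x‖ ^ 2)).mono'
    hmeas.aestronglyMeasurable.norm.integral_prod_right'
    (Filter.Eventually.of_forall fun α => ?_)
  rw [Real.norm_of_nonneg (integral_nonneg fun _ => norm_nonneg _)]
  simp only [Function.uncurry_apply_pair, norm_mul (gaussianWeight s ζ α)]
  rw [integral_const_mul]
  gcongr
  refine (integral_mono (hF_int α).norm (hnf.add (hshift (ξ + c • α))) (hbd _)).trans (le_of_eq ?_)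
  rw [integral_add' hnf (hshift _)]
  congr 1
  exact integral_sub_right_eq_self (fun x => ‖g x‖ ^ 2) (fun k => √2 * ((ξ + c • α) k).re)

theorem ofReal_cpow_half {x : ℝ} (hx : 0 ≤ x) (n : ℕ) :
    (x : ℂ) ^ ((n : ℂ) / 2) = ((√x ^ n : ℝ) : ℂ) := by
  have h : (n : ℂ) / 2 = (((1 / 2 : ℝ) * n : ℝ) : ℂ) := by push_cast; ring
  rw [h, ← Complex.ofReal_cpow hx, Real.rpow_mul hx, Real.rpow_natCast, Real.sqrt_eq_rpow]

/-- The kernel of a Gaussian average of displacements. -/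
def gaussianKernel (s c : ℝ) (ξ ζ : Fin m → ℂ) (x a : Fin m → ℝ) : ℂ :=
  ((√(Real.pi / s) ^ m : ℝ) : ℂ) * Complex.exp (∑ k,
    (-s * a k ^ 2 + 2 * Complex.I * (ζ k).im * a k +
    Complex.I * (ξ k).im * (√2 * x k - (ξ k).re - c * a k) -
    (c * (√2 * x k - (ξ k).re - c * a k) - 2 * (ζ k).re) ^ 2 / (4 * s)))

/-- The imaginary part b of α does not move the argument of g: it enters through the Gaussian and a
phase linear in b, so the b-integral is the Fourier transform of a Gaussian. -/
theorem integral_gaussianWeight_im {s : ℝ} (hs : 0 < s) (c : ℝ) (ξ ζ : Fin m → ℂ)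
    (g : (Fin m → ℝ) → ℂ) (x a : Fin m → ℝ) :
    ∫ b : Fin m → ℝ, gaussianWeight s ζ (fun k => (a k : ℂ) + b k * Complex.I) *
        displaceFun (ξ + c • fun k => (a k : ℂ) + b k * Complex.I) g x =
      g (fun k => x k - √2 * ((ξ k).re + c * a k)) * gaussianKernel s c ξ ζ x a := by
  have h : ∀ b : Fin m → ℝ, gaussianWeight s ζ (fun k => (a k : ℂ) + b k * Complex.I) *
        displaceFun (ξ + c • fun k => (a k : ℂ) + b k * Complex.I) g x =
      (g (fun k => x k - √2 * ((ξ k).re + c * a k)) *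
        Complex.exp (∑ k, (-s * a k ^ 2 + 2 * Complex.I * (ζ k).im * a k +
          Complex.I * (ξ k).im * (√2 * x k - (ξ k).re - c * a k)))) *
      Complex.exp (-s * ∑ k, (b k : ℂ) ^ 2 +
        ∑ k, (Complex.I * (c * (√2 * x k - (ξ k).re - c * a k) - 2 * (ζ k).re)) * b k) := by
    intro b
    have e1 : (fun k => x k - √2 * (((ξ + c • fun k => (a k : ℂ) + b k * Complex.I) k).re)) =
        fun k => x k - √2 * ((ξ k).re + c * a k) := by
      ext k
      simp
    rw [displaceFun, e1, gaussianWeight, mul_comm _ (g _), mul_left_comm, mul_assoc (g _),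
      ← Complex.exp_add, ← Complex.exp_add]
    congr 2
    rw [Complex.ofReal_sum, Finset.mul_sum, Finset.mul_sum, ← Finset.sum_add_distrib,
      ← Finset.sum_add_distrib, ← Finset.sum_add_distrib]
    refine Finset.sum_congr rfl fun k _ => ?_
    have e2 : ((‖(a k : ℂ) + b k * Complex.I‖ : ℝ) : ℂ) ^ 2 = (a k : ℂ) ^ 2 + (b k : ℂ) ^ 2 := by
      rw [← Complex.ofReal_pow, ← Complex.normSq_eq_norm_sq, Complex.normSq_add_mul_I]
      push_cast
      ring
    have e3 : ζ k = (ζ k).re + (ζ k).im * Complex.I := (Complex.re_add_im _).symm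
    have e4 : starRingEnd ℂ (ζ k) = (ζ k).re - (ζ k).im * Complex.I := by
      apply Complex.ext <;> simp
    have e5 : starRingEnd ℂ ((a k : ℂ) + b k * Complex.I) = a k - b k * Complex.I := by
      apply Complex.ext <;> simp
    rw [e2, e4, e5]
    nth_rewrite 1 [e3]
    simp only [Pi.add_apply, Pi.smul_apply, Complex.add_re, Complex.add_im, Complex.real_smul,
      Complex.mul_re, Complex.mul_im, Complex.ofReal_re, Complex.ofReal_im, Complex.I_re,
      Complex.I_im]
    push_cast
    ring
  simp_rw [h]
  rw [integral_const_mul, GaussianFourier.integral_cexp_neg_mul_sum_add (by simpa using hs),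
    Fintype.card_fin, ← Complex.ofReal_div, ofReal_cpow_half (by positivity), gaussianKernel,
    mul_assoc, mul_left_comm (Complex.exp _), ← Complex.exp_add, Finset.sum_div,
    ← Finset.sum_add_distrib]
  congr 3
  refine Finset.sum_congr rfl fun k _ => ?_
  rw [mul_pow, Complex.I_sq]
  ring

theorem integral_gaussian_displaceFun {s : ℝ} (hs : 0 < s) (c : ℝ) (ξ ζ : Fin m → ℂ)
    {f g : (Fin m → ℝ) → ℂ} (hf : StronglyMeasurable f) (hf2 : MemLp f 2 volume)
    (hg : StronglyMeasurable g) (hg2 : MemLp g 2 volume) :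
    ∫ α : Fin m → ℂ, gaussianWeight s ζ α *
        ∫ x, starRingEnd ℂ (f x) * displaceFun (ξ + c • α) g x =
      ∫ x, starRingEnd ℂ (f x) * ∫ a : Fin m → ℝ,
        g (fun k => x k - √2 * ((ξ k).re + c * a k)) * gaussianKernel s c ξ ζ x a := by
  have hF_int := integrable_gaussian_displaceFun hs c ξ ζ hf hf2 hg hg2
  simp_rw [← integral_const_mul]
  rw [integral_integral_swap hF_int]
  refine integral_congr_ae ?_
  filter_upwards [hF_int.prod_left_ae] with x hx
  simp only [Function.uncurry_apply_pair] at hx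
  rw [integral_complexPi hx]
  refine integral_congr_ae (Filter.Eventually.of_forall fun a => ?_)
  simp only
  rw [← integral_gaussianWeight_im hs, ← integral_const_mul]
  refine integral_congr_ae (Filter.Eventually.of_forall fun b => ?_)
  simp only
  ring

end Gaussian

/-! ### Smeared operators -/

section Smear

variable {H X ι : Type*} [NormedAddCommGroup H] [InnerProductSpace ℂ H] [CompleteSpace H]
variable [MeasurableSpace X] {μ : Measure X}

theorem integrable_smul_apply {w : X → ℂ} (hw : Integrable w μ) {O : X → H →L[ℂ] H}
    (hO : ∀ x, ‖O x‖ ≤ 1) (hm : ∀ v, AEStronglyMeasurable (fun x => O x v) μ) (v : H) :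
    Integrable (fun x => w x • O x v) μ := by
  refine (hw.norm.mul_const ‖v‖).mono' (hw.1.smul (hm v)) (Filter.Eventually.of_forall fun x => ?_)
  rw [norm_smul]
  gcongr
  simpa using (O x).le_of_opNorm_le (hO x) v

/-- The operator `∫ w(x) O(x) dx`. -/
theorem exists_smear {w : X → ℂ} (hw : Integrable w μ) {O : X → H →L[ℂ] H}
    (hO : ∀ x, ‖O x‖ ≤ 1) (hm : ∀ v, AEStronglyMeasurable (fun x => O x v) μ) :
    ∃ S : H →L[ℂ] H, ∀ u v, inner ℂ u (S v) = ∫ x, w x * inner ℂ u (O x v) ∂μ := by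
  have hi := integrable_smul_apply hw hO hm
  refine ⟨LinearMap.mkContinuous
    { toFun := fun v => ∫ x, w x • O x v ∂μ
      map_add' := fun u v => by
        simp only [map_add, smul_add]
        exact integral_add (hi u) (hi v)
      map_smul' := fun c v => by
        simp only [map_smul, smul_comm (w _) c, RingHom.id_apply]
        exact integral_smul c _ } (∫ x, ‖w x‖ ∂μ) fun v => ?_, fun u v => ?_⟩
  · change ‖∫ x, w x • O x v ∂μ‖ ≤ _
    rw [← integral_mul_const]
    refine norm_integral_le_of_norm_le (hw.norm.mul_const _)
      (Filter.Eventually.of_forall fun x => ?_)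
    rw [norm_smul]
    gcongr
    simpa using (O x).le_of_opNorm_le (hO x) v
  · change inner ℂ u (∫ x, w x • O x v ∂μ) = _
    rw [← integral_inner (hi v)]
    simp only [inner_smul_right]

/-- The index set of a Hilbert basis may be uncountable; the terms vanish off the countable support
of `b`, to which the exchange of sum and integral is restricted. -/
theorem tsum_integral_eq_of_bound {F : ι → X → ℂ} {b : ι → ℝ} {g : X → ℝ} (hb : Summable b)
    (hg : Integrable g μ) (hF : ∀ i, AEStronglyMeasurable (F i) μ)
    (h : ∀ i x, ‖F i x‖ ≤ b i * g x) : ∑' i, ∫ x, F i x ∂μ = ∫ x, ∑' i, F i x ∂μ := by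
  have hc : Countable (Function.support b) := hb.countable_support.to_subtype
  have hzero : ∀ i ∉ Function.support b, ∀ x, F i x = 0 := fun i hi x => by
    have h0 : b i = 0 := by simpa using hi
    simpa [h0] using h i x
  have h1 : ∑' i, ∫ x, F i x ∂μ = ∑' i : Function.support b, ∫ x, F i x ∂μ := by
    refine (tsum_subtype_eq_of_support_subset fun i hi => ?_).symm
    by_contra hi'
    exact hi (by simp [hzero i hi'])
  have h2 : ∀ x, ∑' i, F i x = ∑' i : Function.support b, F i x := fun x => by
    refine (tsum_subtype_eq_of_support_subset fun i hi => ?_).symm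
    by_contra hi'
    exact hi (hzero i hi' x)
  have hF_int : ∀ i, Integrable (F i) μ := fun i =>
    (hg.const_mul (b i)).mono' (hF i) (Filter.Eventually.of_forall (h i))
  simp_rw [h1, h2]
  refine (hasSum_integral_of_summable_integral_norm
    (F := fun i : Function.support b => F i) (fun i => hF_int i) ?_).tsum_eq
  refine Summable.of_nonneg_of_le (fun i => integral_nonneg fun _ => norm_nonneg _) (fun i => ?_)
    ((hb.subtype (Function.support b)).mul_right (∫ x, g x ∂μ))
  have := integral_mono (hF_int i).norm (hg.const_mul (b i)) (h i)
  rwa [integral_const_mul] at this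

theorem opTrace_smear {P : H →L[ℂ] H} (hP : P.IsPositive) (hT : positiveTrace P ≠ ⊤)
    {w : X → ℂ} (hw : Integrable w μ) {O : X → H →L[ℂ] H}
    (hO : ∀ x, ‖O x‖ ≤ 1) (hm : ∀ v, AEStronglyMeasurable (fun x => O x v) μ) {S : H →L[ℂ] H}
    (hS : ∀ u v, inner ℂ u (S v) = ∫ x, w x * inner ℂ u (O x v) ∂μ) :
    opTrace (P * S) = ∫ x, w x * opTrace (P * O x) ∂μ := by
  simp_rw [opTrace_mul_eq hP hT, hS, ← tsum_mul_left]
  refine tsum_integral_eq_of_bound (summable_sq_norm_sqrtVec hP hT) hw.norm (fun n => ?_)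
    fun n x => ?_
  · exact hw.1.mul (aestronglyMeasurable_const.inner (hm _))
  · rw [norm_mul, mul_comm, sq]
    gcongr
    refine (norm_inner_le_norm _ _).trans ?_
    gcongr
    simpa using (O x).le_of_opNorm_le (hO x) (sqrtVec P n)

/-- Strong continuity suffices against a trace class operator, by the Weierstrass test with majorant
‖√P eₙ‖². -/
theorem continuous_opTrace_mul [TopologicalSpace X] {P : H →L[ℂ] H} (hP : P.IsPositive)
    (hT : positiveTrace P ≠ ⊤) {O : X → H →L[ℂ] H} (hO : ∀ x, ‖O x‖ ≤ 1)
    (hc : ∀ v, Continuous fun x => O x v) : Continuous fun x => opTrace (P * O x) := by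
  simp_rw [opTrace_mul_eq hP hT]
  refine continuous_tsum (fun n => continuous_const.inner (hc _)) (summable_sq_norm_sqrtVec hP hT)
    fun n x => ?_
  refine (norm_inner_le_norm _ _).trans ?_
  rw [sq]
  gcongr
  simpa using (O x).le_of_opNorm_le (hO x) (sqrtVec P n)

end Smear

/-! ### The characteristic function as the Fourier transform of the Wigner function -/

section Wigner

variable {m : ℕ}

theorem inner_displacement (ξ : Fin m → ℂ) (f g : ModeSpace m) :
    inner ℂ f (displacement ξ g) = ∫ x, starRingEnd ℂ (f x) * displaceFun ξ g x := by
  rw [L2.inner_def]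
  refine integral_congr_ae ?_
  filter_upwards [coeFn_displacement ξ g] with x hx
  rw [hx, RCLike.inner_apply, mul_comm]

theorem inner_displacedParity (α : Fin m → ℂ) (f g : ModeSpace m) :
    inner ℂ f (displacedParity α g) =
      ∫ x, starRingEnd ℂ (f x) * displaceFun (0 + (2 : ℝ) • α) (fun x => g (-x)) x := by
  rw [displacedParity_eq, mul_apply_eq_comp, inner_displacement]
  refine integral_congr_ae ?_
  have h2 : 2 • α = 0 + (2 : ℝ) • α := by
    rw [zero_add, two_nsmul, two_smul]
  rw [h2]
  filter_upwards [displaceFun_congr_ae (0 + (2 : ℝ) • α) (coeFn_parity g)] with x hx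
  rw [hx]

theorem gaussianKernel_substitution {t : ℝ} (ht : 0 < t) (ξ : Fin m → ℂ) (x p : Fin m → ℝ) :
    (2 / Real.pi : ℂ) ^ m * (((t / 2) ^ m : ℝ) : ℂ) * gaussianKernel (t ^ 2) 2 0 ξ x
      (fun k => (√2 * x k - (ξ k).re) / 2 - t / 2 * p k) =
    (1 / Real.pi : ℂ) ^ m * gaussianKernel 1 t ξ 0 x p := by
  have ht' : (t : ℂ) ≠ 0 := by exact_mod_cast ht.ne'
  have hpi : (Real.pi : ℂ) ≠ 0 := by exact_mod_cast Real.pi_ne_zero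
  rw [gaussianKernel, gaussianKernel, ← mul_assoc, ← mul_assoc]
  congr 1
  · rw [Real.sqrt_div Real.pi_pos.le, Real.sqrt_sq ht.le, div_one]
    push_cast
    rw [← mul_pow, ← mul_pow, ← mul_pow]
    congr 1
    field_simp
  · congr 1
    refine Finset.sum_congr rfl fun k _ => ?_
    simp only [Pi.zero_apply, Complex.zero_re, Complex.zero_im]
    push_cast
    field_simp
    ring

/-- Formally D(ξ) is the Fourier transform of α ↦ (2/π)ᵐ D(α)ΠD(α)†; Gaussian damping in α becomes
convolution with a Gaussian of width t in ξ. After the imaginary parts are integrated out, both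
sides are integrals of g against explicit kernels, matched by an affine substitution. -/
theorem integral_displacedParity_eq {t : ℝ} (ht : 0 < t) (ξ : Fin m → ℂ) (f g : ModeSpace m) :
    ∫ α, (2 / Real.pi : ℂ) ^ m * gaussianWeight (t ^ 2) ξ α * inner ℂ f (displacedParity α g) =
      ∫ z, (1 / Real.pi : ℂ) ^ m * gaussianWeight 1 0 z *
        inner ℂ f (displacement (ξ + t • z) g) := by
  simp_rw [inner_displacement, inner_displacedParity, mul_assoc, integral_const_mul]
  have hgneg : StronglyMeasurable fun x => g (-x) :=
    (Lp.stronglyMeasurable g).comp_measurable measurable_neg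
  have hgneg2 : MemLp (fun x => g (-x)) 2 volume :=
    (Lp.memLp g).comp_measurePreserving (Measure.measurePreserving_neg volume)
  rw [integral_gaussian_displaceFun (by positivity) 2 0 ξ (Lp.stronglyMeasurable f) (Lp.memLp f)
    hgneg hgneg2, integral_gaussian_displaceFun one_pos t ξ 0 (Lp.stronglyMeasurable f)
    (Lp.memLp f) (Lp.stronglyMeasurable g) (Lp.memLp g), ← integral_const_mul,
    ← integral_const_mul]
  refine integral_congr_ae (Filter.Eventually.of_forall fun x => ?_)
  simp only
  rw [mul_left_comm, mul_left_comm _ (starRingEnd ℂ (f x))]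
  congr 1
  set F : (Fin m → ℝ) → ℂ := fun a =>
    g (-fun k => x k - √2 * (((0 : Fin m → ℂ) k).re + 2 * a k)) *
      gaussianKernel (t ^ 2) 2 0 ξ x a with hF
  -- The substitution a = v - (t/2)p solves 2√2 a - x = x - √2 (Re ξ + tp), so that g has the same
  -- argument on both sides; the Jacobian is (t/2)ᵐ.
  let v : Fin m → ℝ := fun k => (√2 * x k - (ξ k).re) / 2
  have h1 : ∫ a, F a = (((t / 2) ^ m : ℝ) : ℂ) * ∫ p : Fin m → ℝ, F (v - (t / 2) • p) := by
    have h2 := Measure.integral_comp_smul (volume : Measure (Fin m → ℝ))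
      (fun q => F (v - q)) (t / 2)
    rw [integral_sub_left_eq_self F volume v] at h2
    rw [h2, Module.finrank_fin_fun, abs_of_pos (by positivity), Complex.real_smul, ← mul_assoc,
      ← Complex.ofReal_mul, mul_inv_cancel₀ (by positivity), Complex.ofReal_one, one_mul]
  change (2 / Real.pi : ℂ) ^ m * ∫ a, F a = _
  rw [h1, ← mul_assoc, ← integral_const_mul, ← integral_const_mul]
  refine integral_congr_ae (Filter.Eventually.of_forall fun p => ?_)
  simp only [hF]
  have h3 : (-fun k => x k - √2 * (((0 : Fin m → ℂ) k).re + 2 * (v - (t / 2) • p) k)) =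
      fun k => x k - √2 * ((ξ k).re + t * p k) := by
    ext k
    simp only [Pi.neg_apply, Pi.zero_apply, Complex.zero_re, Pi.sub_apply, Pi.smul_apply,
      smul_eq_mul, v]
    have : √2 * √2 = (2 : ℝ) := Real.mul_self_sqrt zero_le_two
    linear_combination x k * this
  rw [h3, mul_left_comm, mul_left_comm _ (g _)]
  congr 1
  exact gaussianKernel_substitution ht ξ x p

theorem integrable_gaussianWeight_prod {s : ℝ} (hs : 0 < s) (c : ℂ)
    (ξ : (Fin m → ℂ) × (Fin m → ℂ)) :
    Integrable fun p : (Fin m → ℂ) × (Fin m → ℂ) =>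
      (c * gaussianWeight s ξ.1 p.1) * (c * gaussianWeight s ξ.2 p.2) :=
  ((integrable_gaussianWeight hs ξ.1).const_mul c).mul_prod
    ((integrable_gaussianWeight hs ξ.2).const_mul c)

theorem norm_displacedParity_le (α : Fin m → ℂ) : ‖displacedParity α‖ ≤ 1 :=
  ContinuousLinearMap.opNorm_le_bound _ zero_le_one fun f => by
    rw [norm_displacedParity_apply, one_mul]

theorem norm_tensorOp_le_one {S T : ModeSpace m →L[ℂ] ModeSpace m} (hS : ‖S‖ ≤ 1) (hT : ‖T‖ ≤ 1) :
    ‖tensorOp S T‖ ≤ 1 :=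
  (norm_tensorOp_le _ _).trans (mul_le_one₀ hS (norm_nonneg _) hT)

theorem continuous_tensorOp_displacedParity (x : Bipartite m) :
    Continuous fun p : (Fin m → ℂ) × (Fin m → ℂ) =>
      tensorOp (displacedParity p.1) (displacedParity p.2) x :=
  continuous_tensorOp norm_displacedParity_le norm_displacedParity_le continuous_displacedParity
    continuous_displacedParity x

theorem continuous_tensorOp_displacement (x : Bipartite m) :
    Continuous fun p : (Fin m → ℂ) × (Fin m → ℂ) =>
      tensorOp (displacement p.1) (displacement p.2) x :=
  continuous_tensorOp norm_displacement_le norm_displacement_le continuous_displacement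
    continuous_displacement x

theorem integral_opTrace_displacedParity_eq {P : Bipartite m →L[ℂ] Bipartite m} (hP : P.IsPositive)
    (hT : positiveTrace P ≠ ⊤) {t : ℝ} (ht : 0 < t) (ξ : (Fin m → ℂ) × (Fin m → ℂ)) :
    ∫ p : (Fin m → ℂ) × (Fin m → ℂ), ((2 / Real.pi : ℂ) ^ m * gaussianWeight (t ^ 2) ξ.1 p.1) *
        ((2 / Real.pi : ℂ) ^ m * gaussianWeight (t ^ 2) ξ.2 p.2) *
        opTrace (P * tensorOp (displacedParity p.1) (displacedParity p.2)) =
      ∫ q : (Fin m → ℂ) × (Fin m → ℂ), ((1 / Real.pi : ℂ) ^ m * gaussianWeight 1 0 q.1) *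
        ((1 / Real.pi : ℂ) ^ m * gaussianWeight 1 0 q.2) *
        opTrace (P * tensorOp (displacement (ξ + t • q).1) (displacement (ξ + t • q).2)) := by
  have hw₁ := integrable_gaussianWeight_prod (by positivity : 0 < t ^ 2) ((2 / Real.pi : ℂ) ^ m) ξ
  have hw₂ := integrable_gaussianWeight_prod one_pos ((1 / Real.pi : ℂ) ^ m)
    (0 : (Fin m → ℂ) × (Fin m → ℂ))
  have hO₁ : ∀ p : (Fin m → ℂ) × (Fin m → ℂ),
      ‖tensorOp (displacedParity p.1) (displacedParity p.2)‖ ≤ 1 := fun p =>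
    norm_tensorOp_le_one (norm_displacedParity_le _) (norm_displacedParity_le _)
  have hO₂ : ∀ q : (Fin m → ℂ) × (Fin m → ℂ),
      ‖tensorOp (displacement (ξ + t • q).1) (displacement (ξ + t • q).2)‖ ≤ 1 := fun p =>
    norm_tensorOp_le_one (norm_displacement_le _) (norm_displacement_le _)
  have hm₁ : ∀ x : Bipartite m, AEStronglyMeasurable (fun p : (Fin m → ℂ) × (Fin m → ℂ) =>
      tensorOp (displacedParity p.1) (displacedParity p.2) x) volume := fun x =>
    (continuous_tensorOp_displacedParity x).aestronglyMeasurable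
  have hm₂ : ∀ x : Bipartite m, AEStronglyMeasurable (fun q : (Fin m → ℂ) × (Fin m → ℂ) =>
      tensorOp (displacement (ξ + t • q).1) (displacement (ξ + t • q).2) x) volume := fun x =>
    ((continuous_tensorOp_displacement x).comp (by fun_prop :
      Continuous fun q : (Fin m → ℂ) × (Fin m → ℂ) => ξ + t • q)).aestronglyMeasurable
  obtain ⟨S₁, hS₁⟩ := exists_smear hw₁ hO₁ hm₁
  obtain ⟨S₂, hS₂⟩ := exists_smear hw₂ hO₂ hm₂
  -- Matrix elements between product vectors factorise over A and B, so the identity for one party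
  -- suffices.
  have hS : S₁ = S₂ := by
    refine ext_productVector fun f g => ext_inner_productVector fun f' g' => ?_
    rw [hS₁, hS₂]
    simp only [tensorOp_productVector, inner_productVector, mul_mul_mul_comm _ _ (inner ℂ f' _)]
    rw [Measure.volume_eq_prod, integral_prod_mul
      (fun α => (2 / Real.pi : ℂ) ^ m * gaussianWeight (t ^ 2) ξ.1 α *
        inner ℂ f' (displacedParity α f))
      (fun α => (2 / Real.pi : ℂ) ^ m * gaussianWeight (t ^ 2) ξ.2 α *
        inner ℂ g' (displacedParity α g)), integral_displacedParity_eq ht,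
      integral_displacedParity_eq ht, ← integral_prod_mul]
    rfl
  rw [← opTrace_smear hP hT hw₁ hO₁ hm₁ hS₁, hS, opTrace_smear hP hT hw₂ hO₂ hm₂ hS₂]
  rfl

/-- The Gaussian regularisation of the Fourier transform of the Wigner function. -/
theorem tendsto_integral_opTrace_displacedParity {P : Bipartite m →L[ℂ] Bipartite m}
    (hP : P.IsPositive) (hT : positiveTrace P ≠ ⊤) (ξ : (Fin m → ℂ) × (Fin m → ℂ)) :
    Filter.Tendsto (fun t : ℝ => ∫ p : (Fin m → ℂ) × (Fin m → ℂ),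
        ((2 / Real.pi : ℂ) ^ m * gaussianWeight (t ^ 2) ξ.1 p.1) *
        ((2 / Real.pi : ℂ) ^ m * gaussianWeight (t ^ 2) ξ.2 p.2) *
        opTrace (P * tensorOp (displacedParity p.1) (displacedParity p.2)))
      (nhdsWithin 0 (Set.Ioi 0))
      (nhds (opTrace (P * tensorOp (displacement ξ.1) (displacement ξ.2)))) := by
  have hcont : Continuous fun p : (Fin m → ℂ) × (Fin m → ℂ) =>
      opTrace (P * tensorOp (displacement p.1) (displacement p.2)) :=
    continuous_opTrace_mul hP hT (fun p => norm_tensorOp_le_one (norm_displacement_le _)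
      (norm_displacement_le _)) continuous_tensorOp_displacement
  have hw := integrable_gaussianWeight_prod one_pos ((1 / Real.pi : ℂ) ^ m)
    (0 : (Fin m → ℂ) × (Fin m → ℂ))
  -- The averaging weight has total mass 1, so the average tends to the value at ξ.
  have hone : ∫ q : (Fin m → ℂ) × (Fin m → ℂ), ((1 / Real.pi : ℂ) ^ m * gaussianWeight 1 0 q.1) *
      ((1 / Real.pi : ℂ) ^ m * gaussianWeight 1 0 q.2) = 1 := by
    have hpi : (Real.pi : ℂ) ≠ 0 := by exact_mod_cast Real.pi_ne_zero
    rw [Measure.volume_eq_prod, integral_prod_mul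
      (fun α : Fin m → ℂ => (1 / Real.pi : ℂ) ^ m * gaussianWeight 1 0 α)
      (fun α : Fin m → ℂ => (1 / Real.pi : ℂ) ^ m * gaussianWeight 1 0 α), integral_const_mul,
      integral_gaussianWeight_one, ← mul_pow, one_div, inv_mul_cancel₀ hpi, one_pow, one_mul]
  have hlim : Filter.Tendsto (fun t : ℝ => ∫ q : (Fin m → ℂ) × (Fin m → ℂ),
        ((1 / Real.pi : ℂ) ^ m * gaussianWeight 1 0 q.1) *
        ((1 / Real.pi : ℂ) ^ m * gaussianWeight 1 0 q.2) *
        opTrace (P * tensorOp (displacement (ξ + t • q).1) (displacement (ξ + t • q).2)))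
      (nhds 0) (nhds (∫ q : (Fin m → ℂ) × (Fin m → ℂ),
        ((1 / Real.pi : ℂ) ^ m * gaussianWeight 1 0 q.1) *
        ((1 / Real.pi : ℂ) ^ m * gaussianWeight 1 0 q.2) *
        opTrace (P * tensorOp (displacement ξ.1) (displacement ξ.2)))) := by
    refine tendsto_integral_filter_of_dominated_convergence
      (fun q => ‖((1 / Real.pi : ℂ) ^ m * gaussianWeight 1 0 q.1) *
        ((1 / Real.pi : ℂ) ^ m * gaussianWeight 1 0 q.2)‖ * (positiveTrace P).toReal)
      (Filter.Eventually.of_forall fun t => ?_) (Filter.Eventually.of_forall fun t =>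
        Filter.Eventually.of_forall fun q => ?_) (hw.norm.mul_const _)
      (Filter.Eventually.of_forall fun q => ?_)
    · exact hw.1.mul (hcont.comp (by fun_prop :
        Continuous fun q : (Fin m → ℂ) × (Fin m → ℂ) => ξ + t • q)).aestronglyMeasurable
    · rw [norm_mul]
      gcongr
      refine (norm_opTrace_mul_le hP hT _).trans (mul_le_of_le_one_right ENNReal.toReal_nonneg ?_)
      exact norm_tensorOp_le_one (norm_displacement_le _) (norm_displacement_le _)
    · refine Filter.Tendsto.const_mul _ ?_
      have h := (hcont.comp (by fun_prop : Continuous fun t : ℝ => ξ + t • q)).tendsto 0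
      simpa [Function.comp_def] using h
  rw [integral_mul_const, hone, one_mul] at hlim
  refine (hlim.mono_left nhdsWithin_le_nhds).congr' ?_
  filter_upwards [self_mem_nhdsWithin] with t ht
  exact (integral_opTrace_displacedParity_eq hP hT ht ξ).symm

end Wigner

/-! ### The witness -/

section Witness

variable {m N : ℕ}

theorem opTrace_displacementA_displacementB (P : Bipartite m →L[ℂ] Bipartite m) (ξ η : Fin m → ℂ) :
    opTrace (P * displacementA ξ * displacementB η) =
      opTrace (P * tensorOp (displacement ξ) (displacement η)) := by
  rw [mul_assoc, displacementA, displacementB, tensorOp_mul, mul_one, one_mul]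

theorem C₂_apply (P : Bipartite m →L[ℂ] Bipartite m) (ξA ξB : Fin N → Fin m → ℂ) (j k : Fin N) :
    C₂ P ξA ξB j k = (1 / (N : ℂ)) *
      opTrace (P * tensorOp (displacement (ξA j - ξA k)) (displacement (ξB j - ξB k))) := by
  rw [← opTrace_displacementA_displacementB]
  rfl

theorem isHermitian_C₂ {P : Bipartite m →L[ℂ] Bipartite m} (hP : P.IsPositive)
    (hT : positiveTrace P ≠ ⊤) (ξA ξB : Fin N → Fin m → ℂ) : (C₂ P ξA ξB).IsHermitian := by
  ext j k
  rw [Matrix.conjTranspose_apply, C₂_apply, C₂_apply, RCLike.star_def, map_mul,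
    ← opTrace_adjoint hP hT, adjoint_tensorOp, adjoint_displacement, adjoint_displacement]
  simp

/-- The quadratic form `∑ⱼₖ vⱼ* Cⱼₖ vₖ`. -/
def quadForm (C : Matrix (Fin N) (Fin N) ℂ) (v : Fin N → ℂ) : ℂ :=
  ∑ j, ∑ k, starRingEnd ℂ (v j) * v k * C j k

theorem realEigenvalues_eq {C : Matrix (Fin N) (Fin N) ℂ} (hC : C.IsHermitian) :
    realEigenvalues C = Set.range hC.eigenvalues := by
  ext μ
  rw [realEigenvalues, Set.mem_ofPred_eq, Module.End.hasEigenvalue_iff_mem_spectrum,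
    Matrix.spectrum_toLin', hC.spectrum_eq_image_range]
  constructor
  · rintro ⟨_, ⟨i, rfl⟩, h⟩
    exact ⟨i, Complex.ofReal_injective h⟩
  · rintro ⟨i, rfl⟩
    exact ⟨_, ⟨i, rfl⟩, rfl⟩

/-- For N > 0 the set of eigenvalues is finite and nonempty, so the infimum in `minEigenvalue` is
attained. -/
theorem isLeast_minEigenvalue (hN : 0 < N) {C : Matrix (Fin N) (Fin N) ℂ} (hC : C.IsHermitian) :
    IsLeast (realEigenvalues C) (minEigenvalue C) := by
  have hfin : (realEigenvalues C).Finite := by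
    rw [realEigenvalues_eq hC]
    exact Set.finite_range _
  have hne : (realEigenvalues C).Nonempty := by
    rw [realEigenvalues_eq hC]
    exact ⟨_, ⟨⟨0, hN⟩, rfl⟩⟩
  exact ⟨hne.csInf_mem hfin, fun μ hμ => csInf_le hfin.bddBelow hμ⟩

theorem exists_quadForm_eq {C : Matrix (Fin N) (Fin N) ℂ} {μ : ℝ} (hμ : μ ∈ realEigenvalues C) :
    ∃ v : Fin N → ℂ, ∑ j, ‖v j‖ ^ 2 = 1 ∧ quadForm C v = μ := by
  obtain ⟨v, hv, hv0⟩ := Module.End.HasEigenvalue.exists_hasEigenvector hμ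
  have hv' : C *ᵥ v = (μ : ℂ) • v := by simpa using Module.End.mem_eigenspace_iff.1 hv
  have hpos : 0 < ∑ j, ‖v j‖ ^ 2 := by
    obtain ⟨j, hj⟩ := Function.ne_iff.1 hv0
    refine Finset.sum_pos' (fun _ _ => sq_nonneg _) ⟨j, Finset.mem_univ _, ?_⟩
    have : 0 < ‖v j‖ := norm_pos_iff.2 hj
    positivity
  have hq : quadForm C v = μ * ((∑ j, ‖v j‖ ^ 2 : ℝ) : ℂ) := by
    rw [quadForm, Complex.ofReal_sum, Finset.mul_sum]
    refine Finset.sum_congr rfl fun j _ => ?_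
    have hj : ∑ k, C j k * v k = μ * v j := by
      have := congrFun hv' j
      simpa [Matrix.mulVec, dotProduct] using this
    simp_rw [mul_assoc, ← Finset.mul_sum, mul_comm (v _) (C j _)]
    rw [hj, ← Complex.normSq_eq_norm_sq, ← Complex.mul_conj]
    ring
  set r := √(∑ j, ‖v j‖ ^ 2) with hr
  have hr0 : 0 < r := Real.sqrt_pos.2 hpos
  have hr2 : r ^ 2 = ∑ j, ‖v j‖ ^ 2 := Real.sq_sqrt hpos.le
  have hrc : (r : ℂ) ≠ 0 := by exact_mod_cast hr0.ne'
  refine ⟨fun j => (r : ℂ)⁻¹ * v j, ?_, ?_⟩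
  · simp_rw [norm_mul, mul_pow]
    rw [← Finset.mul_sum, ← hr2, norm_inv, Complex.norm_real, Real.norm_of_nonneg hr0.le]
    field_simp
  · have : quadForm C (fun j => (r : ℂ)⁻¹ * v j) = (r : ℂ)⁻¹ ^ 2 * quadForm C v := by
      simp_rw [quadForm, Finset.mul_sum]
      refine Finset.sum_congr rfl fun j _ => Finset.sum_congr rfl fun k _ => ?_
      rw [map_mul, map_inv₀, Complex.conj_ofReal]
      ring
    rw [this, hq, ← hr2]
    push_cast
    field_simp

theorem ofReal_witness_le (hN : 0 < N) {P : Bipartite m →L[ℂ] Bipartite m}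
    {ξA ξB : Fin N → Fin m → ℂ} (hC : (C₂ P ξA ξB).IsHermitian) {B : ℝ≥0∞}
    (h : ∀ v : Fin N → ℂ, ∑ j, ‖v j‖ ^ 2 = 1 →
      ENNReal.ofReal (-(quadForm (C₂ P ξA ξB) v).re) ≤ B) :
    ENNReal.ofReal (witness P ξA ξB) ≤ B := by
  obtain ⟨v, hv, hq⟩ := exists_quadForm_eq (isLeast_minEigenvalue hN hC).1
  have := h v hv
  rw [hq, Complex.ofReal_re] at this
  rw [witness, ENNReal.ofReal_max]
  simpa using this

/-- Cauchy–Schwarz. In all three bounds this N cancels the factor 1/N of C₂. -/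
theorem sq_sum_norm_le (v : Fin N → ℂ) (hv : ∑ j, ‖v j‖ ^ 2 = 1) : (∑ j, ‖v j‖) ^ 2 ≤ N := by
  have h := sq_sum_le_card_mul_sum_sq (s := Finset.univ) (f := fun j => ‖v j‖)
  simpa [hv] using h

/-! ### The bound by the trace distance -/

/-- The observable whose expectation is the quadratic form of `C₂`. -/
def witnessOp (ξA ξB : Fin N → Fin m → ℂ) (v : Fin N → ℂ) : Bipartite m →L[ℂ] Bipartite m :=
  ∑ p : Fin N × Fin N, (starRingEnd ℂ (v p.1) * v p.2 * (1 / (N : ℂ))) •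
    tensorOp (displacement (ξA p.1 - ξA p.2)) (displacement (ξB p.1 - ξB p.2))

theorem quadForm_C₂ {P : Bipartite m →L[ℂ] Bipartite m} (hP : P.IsPositive)
    (hT : positiveTrace P ≠ ⊤) (ξA ξB : Fin N → Fin m → ℂ) (v : Fin N → ℂ) :
    quadForm (C₂ P ξA ξB) v = opTrace (P * witnessOp ξA ξB v) := by
  rw [witnessOp, opTrace_mul_sum_right hP hT, Fintype.sum_prod_type, quadForm]
  refine Finset.sum_congr rfl fun j _ => Finset.sum_congr rfl fun k _ => ?_
  rw [C₂_apply, ← mul_assoc]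

theorem norm_witnessOp_le (hN : 0 < N) (ξA ξB : Fin N → Fin m → ℂ) (v : Fin N → ℂ)
    (hv : ∑ j, ‖v j‖ ^ 2 = 1) : ‖witnessOp ξA ξB v‖ ≤ 1 := by
  have hN' : (0 : ℝ) < N := by exact_mod_cast hN
  refine (norm_sum_smul_le _ _ fun p => norm_tensorOp_le_one (norm_displacement_le _)
    (norm_displacement_le _)).trans ?_
  calc _ = ∑ p : Fin N × Fin N, ‖v p.1‖ * ‖v p.2‖ * (1 / N) := by
        refine Finset.sum_congr rfl fun p _ => ?_
        rw [norm_mul, norm_mul, RCLike.norm_conj]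
        simp
    _ = (∑ j, ‖v j‖) ^ 2 / N := by
        rw [← Finset.sum_mul, Fintype.sum_prod_type, sq, Finset.sum_mul_sum]
        ring
    _ ≤ 1 := by
        rw [div_le_one hN']
        exact sq_sum_norm_le v hv

theorem abs_re_quadForm_sub_le (hN : 0 < N) {P Q : Bipartite m →L[ℂ] Bipartite m}
    (hP : P.IsPositive) (hPT : positiveTrace P ≠ ⊤) (hQ : Q.IsPositive)
    (hQT : positiveTrace Q ≠ ⊤) (hPQ : traceNorm (P - Q) ≠ ⊤) (ξA ξB : Fin N → Fin m → ℂ)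
    (v : Fin N → ℂ) (hv : ∑ j, ‖v j‖ ^ 2 = 1) :
    |(quadForm (C₂ P ξA ξB) v).re - (quadForm (C₂ Q ξA ξB) v).re| ≤ (traceNorm (P - Q)).toReal := by
  rw [quadForm_C₂ hP hPT, quadForm_C₂ hQ hQT, ← Complex.sub_re]
  refine (Complex.abs_re_le_norm _).trans ((norm_opTrace_sub_le hP hPT hQ hQT hPQ _).trans ?_)
  exact mul_le_of_le_one_right ENNReal.toReal_nonneg (norm_witnessOp_le hN ξA ξB v hv)

/-! ### The quadratic form in terms of the partial transpose -/

/-- The family of vectors `eₐ ⊗ e_b*`. -/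
def conjProductFamily (m : ℕ) (p : basisIndex (ModeSpace m) × basisIndex (ModeSpace m)) :
    Bipartite m :=
  productVector (basis (ModeSpace m) p.1) (star (basis (ModeSpace m) p.2))

theorem orthonormal_conjProductFamily : Orthonormal ℂ (conjProductFamily m) :=
  orthonormal_productVector (basis (ModeSpace m)).orthonormal
    (orthonormal_star (basis (ModeSpace m)).orthonormal)

/-- The operator `∑ⱼ vⱼ* D(ξⱼᴬ) ⊗ D(-(ξⱼᴮ)*)`. -/
def factorOp (ξA ξB : Fin N → Fin m → ℂ) (v : Fin N → ℂ) : Bipartite m →L[ℂ] Bipartite m :=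
  ∑ j, starRingEnd ℂ (v j) • tensorOp (displacement (ξA j)) (displacement (star (-ξB j)))

theorem enorm_factorOp_sq_le (ξA ξB : Fin N → Fin m → ℂ) (v : Fin N → ℂ)
    (hv : ∑ j, ‖v j‖ ^ 2 = 1) : ‖factorOp ξA ξB v‖ₑ ^ 2 ≤ N := by
  have h : ‖factorOp ξA ξB v‖ ≤ ∑ j, ‖v j‖ := by
    refine (norm_sum_smul_le _ _ fun j => norm_tensorOp_le_one (norm_displacement_le _)
      (norm_displacement_le _)).trans (le_of_eq ?_)
    simp only [RCLike.norm_conj]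
  have h2 : ‖factorOp ξA ξB v‖ ^ 2 ≤ N :=
    (pow_le_pow_left₀ (norm_nonneg (factorOp ξA ξB v)) h 2).trans (sq_sum_norm_le v hv)
  rw [← ofReal_norm, ← ENNReal.ofReal_pow (norm_nonneg _), ← ENNReal.ofReal_natCast]
  exact ENNReal.ofReal_le_ofReal h2

/-- The phase-free factorisation and cyclicity put D(ξ) ⊗ D(η')† and D(η) ⊗ D(ξ')† on the two sides
of P. The partial transpose exchanges the B vectors and conjugates them, so ξ and ξ' end on one side
of S, η and η' on the other: a Gram structure, positive if S is. -/
theorem hasSum_opTrace_partialTranspose {P S : Bipartite m →L[ℂ] Bipartite m} (hP : P.IsPositive)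
    (hT : positiveTrace P ≠ ⊤) (hS : IsPartialTranspose P S) {ξ η ξ' η' : Fin m → ℂ}
    (h : ∑ k, (ξ k * starRingEnd ℂ (η k)).im = ∑ k, (ξ' k * starRingEnd ℂ (η' k)).im) :
    HasSum (fun p => inner ℂ
        (tensorOp (displacement η) (displacement (star (-η'))) (conjProductFamily m p))
        (S (tensorOp (displacement ξ) (displacement (star (-ξ'))) (conjProductFamily m p))))
      (opTrace (P * tensorOp (displacement (ξ - η)) (displacement (ξ' - η')))) := by
  have h1 := hasSum_opTrace_conj hP hT (tensorOp (displacement ξ) (displacement η').adjoint)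
    (tensorOp (displacement η) (displacement ξ').adjoint)
    (productBasis (basis (ModeSpace m)) (basis (ModeSpace m)))
  have h2 : tensorOp (displacement ξ) (displacement η').adjoint ∘L
      (tensorOp (displacement η) (displacement ξ').adjoint).adjoint =
      tensorOp (displacement (ξ - η)) (displacement (ξ' - η')) := by
    refine (tensorOp_displacement_sub h).symm.trans ?_
    rw [displacementA, displacementB, tensorOp_mul, mul_one, one_mul]
  rw [h2] at h1
  convert h1 using 1
  funext p
  rw [conjProductFamily, productBasis_apply, tensorOp_productVector, tensorOp_productVector,
    tensorOp_productVector, tensorOp_productVector, hS, star_displacement, star_displacement,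
    star_star, star_star, adjoint_displacement, adjoint_displacement, star_star]

theorem hasSum_quadForm {P S : Bipartite m →L[ℂ] Bipartite m} (hP : P.IsPositive)
    (hT : positiveTrace P ≠ ⊤) (hS : IsPartialTranspose P S) {ξA ξB : Fin N → Fin m → ℂ}
    (h : ∀ i j, ∑ k, (ξA i k * starRingEnd ℂ (ξA j k)).im =
      ∑ k, (ξB i k * starRingEnd ℂ (ξB j k)).im) (v : Fin N → ℂ) :
    HasSum (fun p => (1 / (N : ℂ)) * inner ℂ (factorOp ξA ξB v (conjProductFamily m p))
      (S (factorOp ξA ξB v (conjProductFamily m p)))) (quadForm (C₂ P ξA ξB) v) := by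
  have h1 := hasSum_sum (s := Finset.univ) fun (j : Fin N) _ =>
    hasSum_sum (s := Finset.univ) fun (k : Fin N) _ =>
    (hasSum_opTrace_partialTranspose hP hT hS (h j k)).mul_left
      (starRingEnd ℂ (v j) * v k * (1 / (N : ℂ)))
  have h2 : quadForm (C₂ P ξA ξB) v = ∑ j, ∑ k, starRingEnd ℂ (v j) * v k * (1 / (N : ℂ)) *
      opTrace (P * tensorOp (displacement (ξA j - ξA k)) (displacement (ξB j - ξB k))) := by
    rw [quadForm]
    refine Finset.sum_congr rfl fun j _ => Finset.sum_congr rfl fun k _ => ?_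
    rw [C₂_apply, ← mul_assoc]
  rw [h2]
  refine Eq.subst (motive := fun F => HasSum F _) (funext fun p => ?_) h1
  simp only [factorOp, sum_apply, smul_apply, map_sum, map_smul, inner_sum, sum_inner,
    inner_smul_left, inner_smul_right, Complex.conj_conj, Finset.mul_sum]
  refine Finset.sum_congr rfl fun j _ => Finset.sum_congr rfl fun k _ => ?_
  ring

theorem re_quadForm_nonneg {P S : Bipartite m →L[ℂ] Bipartite m} (hP : P.IsPositive)
    (hT : positiveTrace P ≠ ⊤) (hS : IsPartialTranspose P S) (hSpos : S.IsPositive)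
    {ξA ξB : Fin N → Fin m → ℂ}
    (h : ∀ i j, ∑ k, (ξA i k * starRingEnd ℂ (ξA j k)).im =
      ∑ k, (ξB i k * starRingEnd ℂ (ξB j k)).im) (v : Fin N → ℂ) :
    0 ≤ (quadForm (C₂ P ξA ξB) v).re := by
  have h1 := (hasSum_quadForm hP hT hS h v).mapL Complex.reCLM
  refine h1.nonneg fun p => ?_
  have h2 : (1 / (N : ℂ)) = ((1 / N : ℝ) : ℂ) := by push_cast; rfl
  rw [h2, Complex.reCLM_apply, Complex.re_ofReal_mul]
  exact mul_nonneg (by positivity) (hSpos.re_inner_nonneg_right _)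

/-- Discards the negative terms of a signed sum; the right side may be infinite. -/
theorem ofReal_le_tsum_of_hasSum {ι : Type*} {f : ι → ℝ} {a : ℝ} (h : HasSum f a) :
    ENNReal.ofReal a ≤ ∑' i, ENNReal.ofReal (f i) := by
  refine le_of_tendsto ((ENNReal.continuous_ofReal.tendsto a).comp h)
    (Filter.Eventually.of_forall fun s => ?_)
  refine le_trans ?_ (ENNReal.sum_le_tsum s)
  exact Finset.le_sum_of_subadditive ENNReal.ofReal ENNReal.ofReal_zero.le
    (fun _ _ => ENNReal.ofReal_add_le) s f

theorem ofReal_neg_quadForm_le_traceNorm_partialTranspose (hN : 0 < N)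
    {P S S' : Bipartite m →L[ℂ] Bipartite m} (hP : P.IsPositive) (hT : positiveTrace P ≠ ⊤)
    (hS : IsPartialTranspose P S) (hS' : S'.IsPositive) {ξA ξB : Fin N → Fin m → ℂ}
    (h : ∀ i j, ∑ k, (ξA i k * starRingEnd ℂ (ξA j k)).im =
      ∑ k, (ξB i k * starRingEnd ℂ (ξB j k)).im) (v : Fin N → ℂ) (hv : ∑ j, ‖v j‖ ^ 2 = 1) :
    ENNReal.ofReal (-(quadForm (C₂ P ξA ξB) v).re) ≤ traceNorm (S' - S) := by
  have hN' : (0 : ℝ) < N := by exact_mod_cast hN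
  have hsa : IsSelfAdjoint (S' - S) :=
    hS'.isSelfAdjoint.sub (isSelfAdjoint_of_isPartialTranspose hP.isSelfAdjoint hS)
  have h1 := ((hasSum_quadForm hP hT hS h v).mapL Complex.reCLM).neg
  have h2 : (1 / (N : ℂ)) = ((1 / N : ℝ) : ℂ) := by push_cast; rfl
  obtain ⟨A, hA, hAT, hle⟩ := exists_isPositive_ge hsa
  refine (ofReal_le_tsum_of_hasSum h1).trans ?_
  calc _ ≤ ∑' p, ENNReal.ofReal (1 / N) *
        ENNReal.ofReal (inner ℂ (factorOp ξA ξB v (conjProductFamily m p))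
          (A (factorOp ξA ξB v (conjProductFamily m p)))).re := by
        refine ENNReal.tsum_le_tsum fun p => ?_
        rw [← ENNReal.ofReal_mul (by positivity)]
        refine ENNReal.ofReal_le_ofReal ?_
        rw [h2, Complex.reCLM_apply, Complex.re_ofReal_mul, ← mul_neg]
        refine mul_le_mul_of_nonneg_left ?_ (by positivity)
        set y := factorOp ξA ξB v (conjProductFamily m p)
        have e1 := hle y
        have e2 : 0 ≤ (inner ℂ y (S' y)).re := hS'.re_inner_nonneg_right y
        rw [sub_apply, inner_sub_right, Complex.sub_re] at e1
        linarith
    _ ≤ ENNReal.ofReal (1 / N) * (N * traceNorm (S' - S)) := by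
        -- The sum is at most ‖F‖² tr A, where ‖F‖² ≤ N and tr A is the trace norm.
        rw [ENNReal.tsum_mul_left]
        gcongr
        refine (tsum_ofReal_re_inner_le hA _ orthonormal_conjProductFamily).trans ?_
        rw [hAT]
        gcongr
        exact enorm_factorOp_sq_le ξA ξB v hv
    _ = traceNorm (S' - S) := by
        rw [← mul_assoc, one_div, ENNReal.ofReal_inv_of_pos hN', ENNReal.ofReal_natCast,
          ENNReal.inv_mul_cancel (by simpa using hN.ne') (by simp), one_mul]

theorem sum_im_eq_of_symplectic {ξA ξB : Fin N → Fin m → ℂ}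
    {Λ : Matrix (Fin m ⊕ Fin m) (Fin m ⊕ Fin m) ℂ} (hΛ : Λᴴ * signMatrix m * Λ = signMatrix m)
    (hΞ : ∀ k, doubled (ξA k) = Λ *ᵥ doubled (ξB k)) (i j : Fin N) :
    ∑ k, (ξA i k * starRingEnd ℂ (ξA j k)).im = ∑ k, (ξB i k * starRingEnd ℂ (ξB j k)).im := by
  have key : ∀ ξ η : Fin m → ℂ, star (doubled η) ⬝ᵥ (signMatrix m *ᵥ doubled ξ) =
      -- The form diag(1,-1) on doubled columns is ∑ (ξη* - ξ*η), hence 2i times the symplectic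
      -- product; its invariance under Λ is the claim.
      2 * Complex.I * ((∑ k, (ξ k * starRingEnd ℂ (η k)).im : ℝ) : ℂ) := by
    intro ξ η
    rw [doubled, doubled, signMatrix, Matrix.fromBlocks_mulVec]
    simp only [dotProduct, Fintype.sum_sum_type, Pi.star_apply, Sum.elim_inl, Sum.elim_inr]
    rw [← Finset.sum_add_distrib, Complex.ofReal_sum, Finset.mul_sum]
    refine Finset.sum_congr rfl fun k _ => ?_
    simp [Matrix.neg_mulVec]
    apply Complex.ext
    · simp
    · simp
      ring
  have h : star (doubled (ξA j)) ⬝ᵥ (signMatrix m *ᵥ doubled (ξA i)) =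
      star (doubled (ξB j)) ⬝ᵥ (signMatrix m *ᵥ doubled (ξB i)) := by
    rw [hΞ, hΞ, Matrix.star_mulVec, ← Matrix.dotProduct_mulVec, Matrix.mulVec_mulVec,
      Matrix.mulVec_mulVec, hΛ]
  rw [key, key] at h
  have h2I : (2 * Complex.I : ℂ) ≠ 0 := by simp
  exact_mod_cast mul_left_cancel₀ h2I h

theorem ofReal_neg_quadForm_le_traceNorm (hN : 0 < N) {P Q : Bipartite m →L[ℂ] Bipartite m}
    (hP : P.IsPositive) (hPT : positiveTrace P ≠ ⊤) (hQ : Q ∈ SEP m) {ξA ξB : Fin N → Fin m → ℂ}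
    (h : ∀ i j, ∑ k, (ξA i k * starRingEnd ℂ (ξA j k)).im =
      ∑ k, (ξB i k * starRingEnd ℂ (ξB j k)).im) (v : Fin N → ℂ) (hv : ∑ j, ‖v j‖ ^ 2 = 1) :
    ENNReal.ofReal (-(quadForm (C₂ P ξA ξB) v).re) ≤ traceNorm (Q - P) := by
  obtain ⟨⟨hQpos, hQ1⟩, hlim⟩ := hQ
  have hQT : positiveTrace Q ≠ ⊤ := by rw [hQ1]; simp
  -- An infinite trace norm makes the bound trivial; otherwise `toReal` is faithful.
  by_cases htop : traceNorm (Q - P) = ⊤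
  · rw [htop]
    exact le_top
  have hsub : convexHull ℝ (productStates m) ⊆ positivePT m :=
    convexHull_min productStates_subset_positivePT convex_positivePT
  -- Nonnegativity holds for mixtures of product states and passes to trace-norm limits, as the form
  -- is 1-Lipschitz in the trace norm.
  have hQnonneg : 0 ≤ (quadForm (C₂ Q ξA ξB) v).re := by
    refine le_of_forall_pos_le_add fun ε hε => ?_
    obtain ⟨τ, hτ, hτε⟩ := hlim (ENNReal.ofReal ε) (ENNReal.ofReal_pos.2 hε)
    obtain ⟨hτpos, hτT, S, hS, hτS⟩ := hsub hτ
    have e1 := abs_re_quadForm_sub_le hN hQpos hQT hτpos hτT (ne_top_of_lt hτε) ξA ξB v hv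
    have e2 := re_quadForm_nonneg hτpos hτT hτS hS h v
    have e3 : (traceNorm (Q - τ)).toReal ≤ ε := ENNReal.toReal_le_of_le_ofReal hε.le hτε.le
    have e4 := (abs_le.1 (e1.trans e3)).1
    linarith
  have e1 := abs_re_quadForm_sub_le hN hQpos hQT hP hPT htop ξA ξB v hv
  refine ENNReal.ofReal_le_of_le_toReal ?_
  have e2 := (abs_le.1 e1).2
  linarith

end Witness

/-! ### The bound by the Wigner negativity volume -/

section Negativity

variable {m N : ℕ}

theorem ofReal_integral_le_lintegral {X : Type*} [MeasurableSpace X] {μ : Measure X} {f : X → ℝ}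
    (hf : Integrable f μ) : ENNReal.ofReal (∫ x, f x ∂μ) ≤ ∫⁻ x, ENNReal.ofReal (f x) ∂μ := by
  refine (ENNReal.ofReal_le_ofReal (integral_mono hf hf.pos_part fun x => le_max_left _ _)).trans ?_
  rw [ofReal_integral_eq_lintegral_ofReal hf.pos_part
    (Filter.Eventually.of_forall fun x => le_max_right _ _)]
  refine lintegral_mono fun x => ?_
  rw [ENNReal.ofReal_max]
  simp

theorem gaussianWeight_eq_mul (s : ℝ) (ζ α : Fin m → ℂ) :
    gaussianWeight s ζ α = ((∏ k, Real.exp (-s * ‖α k‖ ^ 2) : ℝ) : ℂ) * gaussianWeight 0 ζ α := by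
  rw [← Real.exp_sum, Complex.ofReal_exp, gaussianWeight, gaussianWeight, ← Complex.exp_add]
  congr 1
  push_cast
  rw [← Finset.sum_add_distrib]
  refine Finset.sum_congr rfl fun k _ => ?_
  ring

/-- Undamped weights are characters in ζ; this makes the double sum over j and k a squared modulus
in `sum_gaussianWeight_eq`. -/
theorem gaussianWeight_zero_sub (ζ η α : Fin m → ℂ) :
    gaussianWeight 0 (ζ - η) α =
      gaussianWeight 0 ζ α * starRingEnd ℂ (gaussianWeight 0 η α) := by
  rw [gaussianWeight, gaussianWeight, gaussianWeight, ← Complex.exp_conj, ← Complex.exp_add,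
    map_sum, ← Finset.sum_add_distrib]
  congr 1
  refine Finset.sum_congr rfl fun k _ => ?_
  simp
  ring

theorem norm_gaussianWeight_zero (ζ α : Fin m → ℂ) : ‖gaussianWeight 0 ζ α‖ = 1 := by
  rw [norm_gaussianWeight]
  simp

/-- The plane wave sum `∑ⱼ vⱼ* exp(ξⱼ α* - ξⱼ* α)`. -/
def planeWaveSum (ξA ξB : Fin N → Fin m → ℂ) (v : Fin N → ℂ) (p : (Fin m → ℂ) × (Fin m → ℂ)) : ℂ :=
  ∑ j, starRingEnd ℂ (v j) * (gaussianWeight 0 (ξA j) p.1 * gaussianWeight 0 (ξB j) p.2)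

/-- The regularised filter function, with values in `[0, 1]`. -/
def filterFun (t : ℝ) (ξA ξB : Fin N → Fin m → ℂ) (v : Fin N → ℂ)
    (p : (Fin m → ℂ) × (Fin m → ℂ)) : ℝ :=
  (∏ k, Real.exp (-t ^ 2 * ‖p.1 k‖ ^ 2)) * (∏ k, Real.exp (-t ^ 2 * ‖p.2 k‖ ^ 2)) *
    (Complex.normSq (planeWaveSum ξA ξB v p) / N)

theorem filterFun_nonneg (t : ℝ) (ξA ξB : Fin N → Fin m → ℂ) (v : Fin N → ℂ)
    (p : (Fin m → ℂ) × (Fin m → ℂ)) : 0 ≤ filterFun t ξA ξB v p := by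
  have := Complex.normSq_nonneg (planeWaveSum ξA ξB v p)
  unfold filterFun
  positivity

theorem filterFun_le_one (hN : 0 < N) (t : ℝ) (ξA ξB : Fin N → Fin m → ℂ) (v : Fin N → ℂ)
    (hv : ∑ j, ‖v j‖ ^ 2 = 1) (p : (Fin m → ℂ) × (Fin m → ℂ)) : filterFun t ξA ξB v p ≤ 1 := by
  have hN' : (0 : ℝ) < N := by exact_mod_cast hN
  have h1 : ∀ α : Fin m → ℂ, ∏ k, Real.exp (-t ^ 2 * ‖α k‖ ^ 2) ≤ 1 := fun α =>
    Finset.prod_le_one (fun _ _ => (Real.exp_pos _).le) fun k _ => by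
      rw [Real.exp_le_one_iff, neg_mul]
      exact neg_nonpos.2 (by positivity)
  have h2 : ‖planeWaveSum ξA ξB v p‖ ≤ ∑ j, ‖v j‖ := by
    refine (norm_sum_le _ _).trans (le_of_eq (Finset.sum_congr rfl fun j _ => ?_))
    rw [norm_mul, norm_mul, norm_gaussianWeight_zero, norm_gaussianWeight_zero, RCLike.norm_conj,
      mul_one, mul_one]
  have h3 : Complex.normSq (planeWaveSum ξA ξB v p) / N ≤ 1 := by
    rw [div_le_one hN', Complex.normSq_eq_norm_sq]
    exact (pow_le_pow_left₀ (norm_nonneg _) h2 2).trans (sq_sum_norm_le v hv)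
  refine mul_le_one₀ (mul_le_one₀ (h1 _) (by positivity) (h1 _)) ?_ h3
  have := Complex.normSq_nonneg (planeWaveSum ξA ξB v p)
  positivity

theorem sum_gaussianWeight_eq (t : ℝ) (ξA ξB : Fin N → Fin m → ℂ) (v : Fin N → ℂ)
    (p : (Fin m → ℂ) × (Fin m → ℂ)) :
    ∑ j, ∑ k, starRingEnd ℂ (v j) * v k * (1 / (N : ℂ)) *
      (((2 / Real.pi : ℂ) ^ m * gaussianWeight (t ^ 2) (ξA j - ξA k) p.1) *
        ((2 / Real.pi : ℂ) ^ m * gaussianWeight (t ^ 2) (ξB j - ξB k) p.2)) =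
      (((2 / Real.pi) ^ (2 * m) * filterFun t ξA ξB v p : ℝ) : ℂ) := by
  have h : ((Complex.normSq (planeWaveSum ξA ξB v p) : ℝ) : ℂ) =
      ∑ j, ∑ k, (starRingEnd ℂ (v j) *
          (gaussianWeight 0 (ξA j) p.1 * gaussianWeight 0 (ξB j) p.2)) *
        (v k * (starRingEnd ℂ (gaussianWeight 0 (ξA k) p.1) *
          starRingEnd ℂ (gaussianWeight 0 (ξB k) p.2))) := by
    rw [← Complex.mul_conj, planeWaveSum, map_sum, Finset.sum_mul_sum]
    simp only [map_mul, Complex.conj_conj]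
  rw [filterFun]
  push_cast
  rw [h]
  simp only [Finset.mul_sum, Finset.sum_div]
  refine Finset.sum_congr rfl fun j _ => Finset.sum_congr rfl fun k _ => ?_
  rw [gaussianWeight_eq_mul _ (ξA j - ξA k), gaussianWeight_eq_mul _ (ξB j - ξB k),
    gaussianWeight_zero_sub, gaussianWeight_zero_sub]
  push_cast
  ring

theorem continuous_opTrace_displacedParity {P : Bipartite m →L[ℂ] Bipartite m} (hP : P.IsPositive)
    (hT : positiveTrace P ≠ ⊤) : Continuous fun p : (Fin m → ℂ) × (Fin m → ℂ) =>
      opTrace (P * tensorOp (displacedParity p.1) (displacedParity p.2)) :=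
  continuous_opTrace_mul hP hT (fun _ => norm_tensorOp_le_one (norm_displacedParity_le _)
    (norm_displacedParity_le _)) continuous_tensorOp_displacedParity

theorem integrable_gaussianWeight_mul_opTrace {P : Bipartite m →L[ℂ] Bipartite m}
    (hP : P.IsPositive) (hT : positiveTrace P ≠ ⊤) {s : ℝ} (hs : 0 < s) (c : ℂ)
    (ξ : (Fin m → ℂ) × (Fin m → ℂ)) :
    Integrable fun p : (Fin m → ℂ) × (Fin m → ℂ) =>
      (c * gaussianWeight s ξ.1 p.1) * (c * gaussianWeight s ξ.2 p.2) *
        opTrace (P * tensorOp (displacedParity p.1) (displacedParity p.2)) := by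
  refine (integrable_gaussianWeight_prod hs c ξ).mul_bdd (c := (positiveTrace P).toReal)
    (continuous_opTrace_displacedParity hP hT).aestronglyMeasurable
    (Filter.Eventually.of_forall fun p => ?_)
  exact (norm_opTrace_mul_le hP hT _).trans (mul_le_of_le_one_right ENNReal.toReal_nonneg
    (norm_tensorOp_le_one (norm_displacedParity_le _) (norm_displacedParity_le _)))

/-- The damping makes every term integrable because the trace is bounded, so the finite sum may be
taken inside the integral, where it becomes the filter times W. -/
theorem integrable_filterFun_mul_wigner_and_eq {P : Bipartite m →L[ℂ] Bipartite m}
    (hP : P.IsPositive) (hT : positiveTrace P ≠ ⊤) {t : ℝ} (ht : 0 < t)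
    (ξA ξB : Fin N → Fin m → ℂ) (v : Fin N → ℂ) :
    (Integrable fun p => filterFun t ξA ξB v p * wigner P p) ∧
    (∑ j, ∑ k, starRingEnd ℂ (v j) * v k * (1 / (N : ℂ)) *
      ∫ p : (Fin m → ℂ) × (Fin m → ℂ),
        ((2 / Real.pi : ℂ) ^ m * gaussianWeight (t ^ 2) (ξA j - ξA k) p.1) *
        ((2 / Real.pi : ℂ) ^ m * gaussianWeight (t ^ 2) (ξB j - ξB k) p.2) *
        opTrace (P * tensorOp (displacedParity p.1) (displacedParity p.2))).re =
      ∫ p, filterFun t ξA ξB v p * wigner P p := by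
  have hF_int : ∀ j k, Integrable fun p : (Fin m → ℂ) × (Fin m → ℂ) =>
      starRingEnd ℂ (v j) * v k * (1 / (N : ℂ)) *
      (((2 / Real.pi : ℂ) ^ m * gaussianWeight (t ^ 2) (ξA j - ξA k) p.1) *
        ((2 / Real.pi : ℂ) ^ m * gaussianWeight (t ^ 2) (ξB j - ξB k) p.2) *
        opTrace (P * tensorOp (displacedParity p.1) (displacedParity p.2))) := fun j k =>
    (integrable_gaussianWeight_mul_opTrace hP hT (by positivity) _
      (ξA j - ξA k, ξB j - ξB k)).const_mul _
  have hsum : Integrable fun p : (Fin m → ℂ) × (Fin m → ℂ) => ∑ j, ∑ k,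
      starRingEnd ℂ (v j) * v k * (1 / (N : ℂ)) *
      (((2 / Real.pi : ℂ) ^ m * gaussianWeight (t ^ 2) (ξA j - ξA k) p.1) *
        ((2 / Real.pi : ℂ) ^ m * gaussianWeight (t ^ 2) (ξB j - ξB k) p.2) *
        opTrace (P * tensorOp (displacedParity p.1) (displacedParity p.2))) :=
    integrable_finsetSum _ fun j _ => integrable_finsetSum _ fun k _ => hF_int j k
  have hre : ∀ p : (Fin m → ℂ) × (Fin m → ℂ), (∑ j, ∑ k,
      starRingEnd ℂ (v j) * v k * (1 / (N : ℂ)) *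
      (((2 / Real.pi : ℂ) ^ m * gaussianWeight (t ^ 2) (ξA j - ξA k) p.1) *
        ((2 / Real.pi : ℂ) ^ m * gaussianWeight (t ^ 2) (ξB j - ξB k) p.2) *
        opTrace (P * tensorOp (displacedParity p.1) (displacedParity p.2)))).re =
      filterFun t ξA ξB v p * wigner P p := fun p => by
    have h : filterFun t ξA ξB v p * wigner P p =
        ((((2 / Real.pi) ^ (2 * m) * filterFun t ξA ξB v p : ℝ) : ℂ) *
          opTrace (P * tensorOp (displacedParity p.1) (displacedParity p.2))).re := by
      rw [Complex.re_ofReal_mul, wigner]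
      ring
    rw [h, ← sum_gaussianWeight_eq]
    simp only [Finset.sum_mul, mul_assoc]
  refine ⟨?_, ?_⟩
  · simp_rw [← hre]
    exact hsum.re
  · simp_rw [← hre, ← integral_const_mul]
    simp_rw [fun j => (integral_finsetSum Finset.univ fun k _ => hF_int j k).symm]
    rw [← integral_finsetSum _ fun j _ => integrable_finsetSum _ fun k _ => hF_int j k]
    exact (Complex.reCLM.integral_comp_comm hsum).symm

theorem ofReal_neg_integral_le_negativityVolume (hN : 0 < N)
    {P : Bipartite m →L[ℂ] Bipartite m} (t : ℝ)
    (ξA ξB : Fin N → Fin m → ℂ) (v : Fin N → ℂ) (hv : ∑ j, ‖v j‖ ^ 2 = 1)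
    (hF_int : Integrable fun p => filterFun t ξA ξB v p * wigner P p) :
    ENNReal.ofReal (-∫ p, filterFun t ξA ξB v p * wigner P p) ≤ negativityVolume P := by
  rw [← integral_neg]
  refine (ofReal_integral_le_lintegral hF_int.neg).trans (lintegral_mono fun p => ?_)
  refine ENNReal.ofReal_le_ofReal ?_
  have h0 := filterFun_nonneg t ξA ξB v p
  have h1 := filterFun_le_one hN t ξA ξB v hv p
  have h2 : 0 ≤ (|wigner P p| - wigner P p) / 2 := by linarith [le_abs_self (wigner P p)]
  calc -(filterFun t ξA ξB v p * wigner P p)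
      = filterFun t ξA ξB v p * -wigner P p := by ring
    -- -W is at most its negative part (|W| - W)/2, and the filter lies in [0, 1].
    _ ≤ filterFun t ξA ξB v p * ((|wigner P p| - wigner P p) / 2) :=
        mul_le_mul_of_nonneg_left (by linarith [neg_le_abs (wigner P p)]) h0
    _ ≤ _ := mul_le_of_le_one_left h2 h1

theorem ofReal_neg_quadForm_le_negativityVolume (hN : 0 < N) {P : Bipartite m →L[ℂ] Bipartite m}
    (hP : P.IsPositive) (hT : positiveTrace P ≠ ⊤) (ξA ξB : Fin N → Fin m → ℂ) (v : Fin N → ℂ)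
    (hv : ∑ j, ‖v j‖ ^ 2 = 1) :
    ENNReal.ofReal (-(quadForm (C₂ P ξA ξB) v).re) ≤ negativityVolume P := by
  have hlim : Filter.Tendsto (fun t : ℝ => ∑ j, ∑ k, starRingEnd ℂ (v j) * v k * (1 / (N : ℂ)) *
      ∫ p : (Fin m → ℂ) × (Fin m → ℂ),
        ((2 / Real.pi : ℂ) ^ m * gaussianWeight (t ^ 2) (ξA j - ξA k) p.1) *
        ((2 / Real.pi : ℂ) ^ m * gaussianWeight (t ^ 2) (ξB j - ξB k) p.2) *
        opTrace (P * tensorOp (displacedParity p.1) (displacedParity p.2)))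
      (nhdsWithin 0 (Set.Ioi 0)) (nhds (quadForm (C₂ P ξA ξB) v)) := by
    have h : quadForm (C₂ P ξA ξB) v = ∑ j, ∑ k, starRingEnd ℂ (v j) * v k * (1 / (N : ℂ)) *
        opTrace (P * tensorOp (displacement (ξA j - ξA k)) (displacement (ξB j - ξB k))) := by
      rw [quadForm]
      refine Finset.sum_congr rfl fun j _ => Finset.sum_congr rfl fun k _ => ?_
      rw [C₂_apply, ← mul_assoc]
    rw [h]
    exact tendsto_finsetSum _ fun j _ => tendsto_finsetSum _ fun k _ =>
      (tendsto_integral_opTrace_displacedParity hP hT (ξA j - ξA k, ξB j - ξB k)).const_mul _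
  have hlim' := (ENNReal.continuous_ofReal.tendsto _).comp
    (((Complex.continuous_re.tendsto _).comp hlim).neg)
  -- The bound holds for every t > 0 with a right side independent of t, so the limit needs no
  -- integrability of W.
  refine le_of_tendsto hlim' ?_
  filter_upwards [self_mem_nhdsWithin] with t ht
  obtain ⟨hF_int, heq⟩ := integrable_filterFun_mul_wigner_and_eq hP hT ht ξA ξB v
  simp only [Function.comp_apply]
  rw [heq]
  exact ofReal_neg_integral_le_negativityVolume hN t ξA ξB v hv hF_int

end Negativity

end ECDWitness

end

/-! ### The main theorem -/

theorem corollary1 (m N : ℕ) (hN : 0 < N) (ξA ξB : Fin N → Fin m → ℂ)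
    (Λ : Matrix (Fin m ⊕ Fin m) (Fin m ⊕ Fin m) ℂ)
    (hΛ : Λᴴ * ECDWitness.signMatrix m * Λ = ECDWitness.signMatrix m)
    (hΞ : ∀ k, ECDWitness.doubled (ξA k) = Λ *ᵥ ECDWitness.doubled (ξB k))
    (ρ : ECDWitness.Bipartite m →L[ℂ] ECDWitness.Bipartite m) (hρ : ECDWitness.IsState ρ) :
    -- the partial transpose and the smallest eigenvalue are well defined
    (∀ σ : ECDWitness.Bipartite m →L[ℂ] ECDWitness.Bipartite m, ECDWitness.IsState σ →
      ECDWitness.IsPartialTranspose σ (ECDWitness.partialTranspose σ)) ∧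
    (ECDWitness.C₂ ρ ξA ξB).IsHermitian ∧
    IsLeast (ECDWitness.realEigenvalues (ECDWitness.C₂ ρ ξA ξB))
      (ECDWitness.minEigenvalue (ECDWitness.C₂ ρ ξA ξB)) ∧
    -- the lower bounds
    ENNReal.ofReal (ECDWitness.witness ρ ξA ξB) ≤ ECDWitness.entanglementSEP ρ ∧
    ENNReal.ofReal (ECDWitness.witness ρ ξA ξB) ≤ ECDWitness.entanglementPPT ρ ∧
    ENNReal.ofReal (ECDWitness.witness ρ ξA ξB) ≤ ECDWitness.negativityVolume ρ ∧
    -- the certificates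
    (0 < ECDWitness.witness ρ ξA ξB →
      ρ ∉ ECDWitness.SEP m ∧ ρ ∉ ECDWitness.PPT m ∧ ∃ α, ECDWitness.wigner ρ α < 0) := by
  open ECDWitness in
  have hfin : ∀ {σ : Bipartite m →L[ℂ] Bipartite m}, IsState σ → positiveTrace σ ≠ ⊤ :=
    fun hσ => by rw [hσ.2]; simp
  have hPT : ∀ σ : Bipartite m →L[ℂ] Bipartite m, IsState σ →
      IsPartialTranspose σ (partialTranspose σ) := fun σ hσ =>
    isPartialTranspose_partialTranspose hσ.1 (hfin hσ)
  have hC := isHermitian_C₂ hρ.1 (hfin hρ) ξA ξB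
  have hsymp := sum_im_eq_of_symplectic hΛ hΞ
  have hSEP : ENNReal.ofReal (witness ρ ξA ξB) ≤ entanglementSEP ρ :=
    le_iInf₂ fun σ hσ => ofReal_witness_le hN hC fun v hv =>
      ofReal_neg_quadForm_le_traceNorm hN hρ.1 (hfin hρ) hσ hsymp v hv
  have hPPT : ENNReal.ofReal (witness ρ ξA ξB) ≤ entanglementPPT ρ :=
    le_iInf₂ fun σ hσ => ofReal_witness_le hN hC fun v hv =>
      ofReal_neg_quadForm_le_traceNorm_partialTranspose hN hρ.1 (hfin hρ) (hPT ρ hρ) hσ.2 hsymp v hv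
  have hneg : ENNReal.ofReal (witness ρ ξA ξB) ≤ negativityVolume ρ :=
    ofReal_witness_le hN hC fun v hv =>
      ofReal_neg_quadForm_le_negativityVolume hN hρ.1 (hfin hρ) ξA ξB v hv
  refine ⟨hPT, hC, isLeast_minEigenvalue hN hC, hSEP, hPPT, hneg, fun hw => ?_⟩
  have hw' : 0 < ENNReal.ofReal (witness ρ ξA ξB) := ENNReal.ofReal_pos.2 hw
  refine ⟨fun h => ?_, fun h => ?_, ?_⟩
  -- A separable ρ competes in its own infimum, which is then 0 and contradicts the positive lower
  -- bound; likewise for PPT.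
  · have h0 : entanglementSEP ρ ≤ traceNorm (ρ - ρ) := iInf₂_le ρ h
    rw [sub_self, traceNorm_zero] at h0
    exact (hw'.trans_le (hSEP.trans h0)).false
  · have h0 : entanglementPPT ρ ≤ traceNorm (partialTranspose ρ - partialTranspose ρ) :=
      iInf₂_le ρ h
    rw [sub_self, traceNorm_zero] at h0
    exact (hw'.trans_le (hPPT.trans h0)).false
  · by_contra! hall
    have h0 : negativityVolume ρ = 0 := by
      rw [negativityVolume]
      simp_rw [fun α => abs_of_nonneg (hall α)]
      simp
    rw [h0] at hneg
    exact (hw'.trans_le hneg).false
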